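/- **Setting.** A system qubit $\mathsf S$ and an environment qubit $\mathsf E$ evolve under $H(\omega)=\frac{\omega}{2}\sigma_Z^{\mathsf S}+\mathbb 1+g\,\mathrm{SWAP}$, with the environment initially in $|0\rangle$; $\omega$ is the unknown frequency. Put $\Omega=\sqrt{g^2+\omega^2/4}$ and $\epsilon^\ast=\pi/(2\Omega T)$. A free-evolution (FE) strategy consists of a finite-dimensional ancilla, a probe state (density matrix) of system and ancilla, a finite-outcome POVM on system and ancilla, and an arbitrary real-valued estimator $\hat\omega$ of the $\nu\ge1$ outcomes. In each of $\nu$ runs the probe evolves freely, without control, and is measured. If the set duration is $T$, the actual duration is $T(1+u)$, where $u$ has an unknown distribution $f$. The outcomes are $\nu$ i.i.d. samples of the outcome distribution averaged over $u\sim f$. Let $\mathcal F^Q_\omega[\xi,\mathrm{FE}]$ be the quantum Fisher information (via the symmetric logarithmic derivative) about $\omega$ of the system–ancilla state after actual duration $T(1+\xi)$ (that is, for $f=\delta(u-\xi)$), maximized over ancillas and probe states. Without environment ($g=0$) and for $\xi=0$ it equals $T^2$; the Heisenberg limit is $1/(\nu T^2)$. Let $\mathcal R(f,s)=\mathrm E[(\hat\omega-\omega)^2]$,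 and let $b_{f}(\omega)=\mathrm E(\hat\omega)-\omega$ be the bias. Let $\mathcal N$ be either the set of delta distributions $\delta(u-\xi)$, $|\xi|\le\epsilon$, or the set of all probability distributions on $[-\epsilon,\epsilon]$. As in local estimation around the reference frequency $0$, for $0\le\kappa\le1$ only strategies are admitted whose bias is linear, $b_f(\omega)=m\,\omega$ with $m=\partial_\omega b_f(\omega)$, up to a remainder: $|b_f(\omega)-\omega\,\partial_\omega b_f(\omega)|\le\kappa|\omega|$ for every $f\in\mathcal N$. Put $\mathcal L_{\mathrm{FE}}=\inf_s\sup_{f\in\mathcal N}\mathcal R(f,s)$ over these strategies. **Statement.** Here $\omega,\xi$ are real, $T>0$, $\epsilon\ge0$. 1. (Bias-optimized biased Cramér–Rao bound.) For $g\ge 0$ and $\omega\ne0$, $$\mathcal L_{\mathrm{FE}}\ \ge\ \sup_{|\xi|\le\epsilon}\frac{(1-\kappa)^2}{\omega^{-2}+\nu\,\mathcal F^Q_\omega[\xi,\mathrm{FE}]}.$$ There is an absolute constant $C>0$ such that, for all $g>0$ and $|\omega|\le g$, claims 2–4 hold. 2. (QFI bound.) With $t=T(1+\xi)$, $$\mathcal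 F^Q_\omega[\xi,\mathrm{FE}]\le\frac{2\,[g t\cos(\Omega t)+\sin(\Omega t)]^2}{g^2(\cos(2\Omega t)+3)}+C\,\frac{\omega^2t^2}{g^2}.$$ If moreover $|\xi|\le1$ and $T$ is so large that $T\ge g/\omega^2$ (with $\omega\neq0$), then $$\mathcal F^Q_\omega[\xi,\mathrm{FE}]\le\frac{2T^2(1+\xi)^2\cos^2[T\Omega(1+\xi)]}{\cos[2T(1+\xi)\Omega]+3}+C\,\frac{\omega^2T^2}{g^2}.$$ 3. If $\omega\ne0$, $gT\ge1$ and $\epsilon\ge\epsilon^\ast$, then $$\mathcal L_{\mathrm{FE}}\ge(1-\kappa)^2\left[\Bigl(1-\frac{C}{gT}\Bigr)\frac{g^2\omega^2}{\nu\omega^4T^2+g^2}-C\,\frac{\nu\omega^8T^2}{(g^2+\nu T^2\omega^4)^2}\right].$$ 4. If $\omega\ne0$, $gT\ge1$ and $\epsilon<\epsilon^\ast$, then $$\mathcal L_{\mathrm{FE}}\ge(1-\kappa)^2\left[\Bigl(1-\frac{C}{gT}\Bigr)\frac{1}{\nu T^2\left[\frac{\omega^2}{g^2}+\cos^2(\epsilon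 T\Omega)\right]+\omega^{-2}}-C\,\frac{\omega^4}{\nu T^2\,[g^2\cos^2(T\Omega\epsilon)+\omega^2]^2}\right].$$ 5. For fixed $g>0$ and $\omega\ne0$, the ratio of $g^2\omega^2/(\nu\omega^4T^2+g^2)$ to the Heisenberg limit $1/(\nu T^2)$ tends to $g^2/\omega^2$ as $\nu,T\to\infty$. -/

import Mathlib

open Matrix MeasureTheory Filter Topology
open scoped Kronecker ENNReal ComplexOrder

noncomputable section

namespace TDI

/-- A density matrix: positive semidefinite of trace one. -/
structure DensityMatrix (n : Type) [Fintype n] where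
  mat : Matrix n n ℂ
  posSemidef : mat.PosSemidef
  trace_eq_one : mat.trace = 1

/-- The Pauli matrix `σ_Z`. -/
def pauliZ : Matrix (Fin 2) (Fin 2) ℂ := !![1, 0; 0, -1]

/-- The SWAP gate on system ⊗ environment, `|s e⟩ ↦ |e s⟩`. -/
def swapGate : Matrix (Fin 2 × Fin 2) (Fin 2 × Fin 2) ℂ :=
  Matrix.of fun p q => if p.1 = q.2 ∧ p.2 = q.1 then 1 else 0

/-- The joint Hamiltonian `H(ω) = H_S(ω) + H_E + H_SE` on system ⊗ environment, with
`H_S = (ω/2) σ_Z`, `H_E` the identity, `H_SE = g SWAP`. -/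
def hamiltonian (g ω : ℝ) : Matrix (Fin 2 × Fin 2) (Fin 2 × Fin 2) ℂ :=
  ((ω / 2 : ℝ) : ℂ) • (pauliZ ⊗ₖ (1 : Matrix (Fin 2) (Fin 2) ℂ)) + 1 + (g : ℂ) • swapGate

/-- The free evolution `exp(-i t H)`. -/
def evolution (g ω t : ℝ) : Matrix (Fin 2 × Fin 2) (Fin 2 × Fin 2) ℂ :=
  NormedSpace.exp ((-(Complex.I * (t : ℂ))) • hamiltonian g ω)

/-- Adjoin the environment in the state `|0⟩⟨0|` to an operator on system ⊗ ancilla; the result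
acts on (system ⊗ environment) ⊗ ancilla. -/
def adjoinEnv {d : ℕ} (ρ : Matrix (Fin 2 × Fin d) (Fin 2 × Fin d) ℂ) :
    Matrix ((Fin 2 × Fin 2) × Fin d) ((Fin 2 × Fin 2) × Fin d) ℂ :=
  Matrix.of fun p q =>
    if p.1.2 = 0 ∧ q.1.2 = 0 then ρ (p.1.1, p.2) (q.1.1, q.2) else 0

/-- Partial trace over the environment. -/
def traceEnv {d : ℕ} (σ : Matrix ((Fin 2 × Fin 2) × Fin d) ((Fin 2 × Fin 2) × Fin d) ℂ) :
    Matrix (Fin 2 × Fin d) (Fin 2 × Fin d) ℂ :=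
  Matrix.of fun p q => ∑ e : Fin 2, σ ((p.1, e), p.2) ((q.1, e), q.2)

/-- The state of system ⊗ ancilla after joint free evolution for the actual duration `t`,
starting from the probe state `ρ` and the environment state `|0⟩`. -/
def finalState (g ω t : ℝ) {d : ℕ} (ρ : DensityMatrix (Fin 2 × Fin d)) :
    Matrix (Fin 2 × Fin d) (Fin 2 × Fin d) ℂ :=
  let U := evolution g ω t ⊗ₖ (1 : Matrix (Fin d) (Fin d) ℂ)
  traceEnv (U * adjoinEnv ρ.mat * Uᴴ)

/-- `L` is a symmetric logarithmic derivative at `ω` of the family of states `ρ`. The derivative of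
the matrix-valued function is taken entrywise. -/
def IsSLD {n : Type} [Fintype n] (ρ : ℝ → Matrix n n ℂ) (ω : ℝ) (L : Matrix n n ℂ) : Prop :=
  L.IsHermitian ∧
    (Matrix.of fun i j => deriv (fun w => ρ w i j) ω) = (1 / 2 : ℂ) • (ρ ω * L + L * ρ ω)

/-- The quantum Fisher information `Tr(ρ L²)`, `L` a symmetric logarithmic derivative. The value is
the same for every such `L`; it is `∞` when there is none. -/
def qfi {n : Type} [Fintype n] (ρ : ℝ → Matrix n n ℂ) (ω : ℝ) : ℝ≥0∞ :=
  ⨅ (L : Matrix n n ℂ) (_ : IsSLD ρ ω L), ENNReal.ofReal ((ρ ω * L * L).trace.re)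

/-- The quantum Fisher information about `ω` of the state before the measurement, maximized over
all free-evolution strategies (every ancilla dimension, every probe state), when the actual
duration of the evolution is `t`. -/
def qfiFE (g ω t : ℝ) : ℝ≥0∞ :=
  ⨆ (d : ℕ) (ρ : DensityMatrix (Fin 2 × Fin d)), qfi (fun w => finalState g w t ρ) ω

/-- A free-evolution strategy with `ν` repetitions: an ancilla, a probe state of system ⊗ ancilla, a
measurement (a POVM on system ⊗ ancilla), and an estimator that maps the `ν` outcomes to a number. -/
structure FEStrategy (ν : ℕ) where
  ancillaDim : ℕ
  probe : DensityMatrix (Fin 2 × Fin ancillaDim)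
  numOutcomes : ℕ
  povm : Fin numOutcomes → Matrix (Fin 2 × Fin ancillaDim) (Fin 2 × Fin ancillaDim) ℂ
  povm_posSemidef : ∀ x, (povm x).PosSemidef
  povm_sum : ∑ x, povm x = 1
  estimator : (Fin ν → Fin numOutcomes) → ℝ

namespace FEStrategy

variable {ν : ℕ} (s : FEStrategy ν)

/-- Probability of the outcome `x` in one run whose actual duration is `t` (Born rule). -/
def prob (g ω t : ℝ) (x : Fin s.numOutcomes) : ℝ :=
  ((finalState g ω t s.probe * s.povm x).trace).re

/-- The effective single-run outcome distribution `p_f`: the set duration `T` becomes `T (1 + u)`,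
with `u` distributed according to `f`. -/
def effProb (g ω T : ℝ) (f : ProbabilityMeasure ℝ) (x : Fin s.numOutcomes) : ℝ :=
  ∫ u, s.prob g ω (T * (1 + u)) x ∂(f : Measure ℝ)

/-- Expectation of a function of `ν` independent outcomes distributed according to `p_f`. -/
def expect (g ω T : ℝ) (f : ProbabilityMeasure ℝ)
    (F : (Fin ν → Fin s.numOutcomes) → ℝ) : ℝ :=
  ∑ x, (∏ i, s.effProb g ω T f (x i)) * F x

/-- The bias `E(ω̂) - ω`. -/
def bias (g ω T : ℝ) (f : ProbabilityMeasure ℝ) : ℝ :=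
  s.expect g ω T f s.estimator - ω

/-- The mean squared error `E[(ω̂ - ω)²]`. -/
def mse (g ω T : ℝ) (f : ProbabilityMeasure ℝ) : ℝ :=
  s.expect g ω T f fun x => (s.estimator x - ω) ^ 2

/-- The bias, as a function `b` of the frequency, has near the true value `ω` the form `m ω` of a
linear function vanishing at the reference value `0`, where `m = b'(ω)`, up to a
remainder of size at most `κ |ω|`. -/
def BiasLinear (κ g ω T : ℝ) (f : ProbabilityMeasure ℝ) : Prop :=
  |s.bias g ω T f - deriv (fun w => s.bias g w T f) ω * ω| ≤ κ * |ω|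

end FEStrategy

/-- All distributions of the time imperfection that are supported in `[-ε, ε]`. -/
def boundedTDI (ε : ℝ) : Set (ProbabilityMeasure ℝ) :=
  {f | (f : Measure ℝ) (Set.Icc (-ε) ε)ᶜ = 0}

/-- The delta distributions `δ(u - ξ)` with `ξ ∈ [-ε, ε]`. -/
def deltaTDI (ε : ℝ) : Set (ProbabilityMeasure ℝ) :=
  {f | ∃ ξ ∈ Set.Icc (-ε) ε, (f : Measure ℝ) = Measure.dirac ξ}

/-- The loss `L_FE = inf_s sup_f R(f, s)`: `f` ranges over the set `𝒩`, and `s` over the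
free-evolution strategies whose bias is linear up to relative size `κ` for each `f` in `𝒩`. -/
def lossFE (κ : ℝ) (𝒩 : Set (ProbabilityMeasure ℝ)) (ν : ℕ) (g ω T : ℝ) : ℝ≥0∞ :=
  ⨅ (s : FEStrategy ν) (_ : ∀ f ∈ 𝒩, s.BiasLinear κ g ω T f),
    ⨆ f ∈ 𝒩, ENNReal.ofReal (s.mse g ω T f)

/-- `Ω = √(g² + ω²/4)`. -/
def rabi (g ω : ℝ) : ℝ := Real.sqrt (g ^ 2 + ω ^ 2 / 4)

/-- The threshold `ε* = π / (2ΩT)`. -/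
def epsStar (g ω T : ℝ) : ℝ := Real.pi / (2 * rabi g ω * T)

/-- The Heisenberg limit `1 / (ν T²)`. -/
def heisenbergLimit (ν : ℕ) (T : ℝ) : ℝ := 1 / (ν * T ^ 2)

/-- The lower bound `g²ω² / (νω⁴T² + g²)` for `ε ≥ ε*`. -/
def boundLarge (ν : ℕ) (g ω T : ℝ) : ℝ :=
  g ^ 2 * ω ^ 2 / (ν * ω ^ 4 * T ^ 2 + g ^ 2)

/-- The lower bound `1 / {νT² [ω²/g² + cos²(εTΩ)] + ω⁻²}` for `ε < ε*`. -/
def boundSmall (ν : ℕ) (g ω T ε : ℝ) : ℝ :=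
  1 / (ν * T ^ 2 * (ω ^ 2 / g ^ 2 + Real.cos (ε * T * rabi g ω) ^ 2) + 1 / ω ^ 2)

end TDI

end

/-!
An environment prepared in `|0⟩` turns the evolution into a qubit channel with two Kraus operators.
Rotating the environment basis by an `ω`-dependent unitary does not change the channel, so the
quantum Fisher information of every probe is at most `4 ‖∑ₑ Dₑᴴ Dₑ‖`, where the `Dₑ` are the
derivatives of the Kraus operators in an arbitrary gauge. It suffices to use gauges that shift the
phase of `|0⟩`. The best of them gives the bound with the denominator `cos (2Ωt) + 3`. The one that
makes the amplitude of `|0⟩` stationary gives, with `θ = Ωt`, a bound governed by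
`(θ cos θ + sin θ)² = (1 + θ²) sin² (θ + arctan θ)`. This is small when `θ + arctan θ` is close to a
multiple of `π`, and some duration in `[T (1 - ε), T (1 + ε)]` comes near such a point; for
`ε ≥ ε*` it can be reached exactly, and only a Fisher information of order `T² ω² / g²` remains.

For a fixed duration, the Cauchy–Schwarz inequality for the estimation error and the score shifted
by `-1 / ω` gives the Cramér–Rao bound: the shift cancels the contribution of any linear bias, whose
slope is unrestricted. Both classes of distributions contain the delta distributions, so each of
these bounds is a bound on the loss.
-/

namespace TDI

section EntrywiseDerivative

variable {l m n ι : Type*} [Fintype m] {ω : ℝ}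

/-- `A'` is the derivative at `ω` of the matrix-valued function `A`, entry by entry; this is the
derivative that `IsSLD` refers to. -/
def HasEntrywiseDerivAt (A : ℝ → Matrix l n ℂ) (A' : Matrix l n ℂ) (ω : ℝ) : Prop :=
  ∀ i j, HasDerivAt (fun w => A w i j) (A' i j) ω

namespace HasEntrywiseDerivAt

lemma const (A : Matrix l n ℂ) : HasEntrywiseDerivAt (fun _ => A) 0 ω :=
  fun i j => hasDerivAt_const ω (A i j)

lemma mul {A : ℝ → Matrix l m ℂ} {B : ℝ → Matrix m n ℂ} {A' : Matrix l m ℂ} {B' : Matrix m n ℂ}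
    (hA : HasEntrywiseDerivAt A A' ω) (hB : HasEntrywiseDerivAt B B' ω) :
    HasEntrywiseDerivAt (fun w => A w * B w) (A' * B ω + A ω * B') ω := by
  intro i j
  simp only [Matrix.add_apply, Matrix.mul_apply, ← Finset.sum_add_distrib]
  exact HasDerivAt.fun_sum fun k _ => (hA i k).mul (hB k j)

lemma conjTranspose {A : ℝ → Matrix l n ℂ} {A' : Matrix l n ℂ}
    (hA : HasEntrywiseDerivAt A A' ω) : HasEntrywiseDerivAt (fun w => (A w)ᴴ) A'ᴴ ω :=
  fun i j => (hA j i).star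

lemma sum {s : Finset ι} {A : ι → ℝ → Matrix l n ℂ} {A' : ι → Matrix l n ℂ}
    (hA : ∀ e ∈ s, HasEntrywiseDerivAt (A e) (A' e) ω) :
    HasEntrywiseDerivAt (fun w => ∑ e ∈ s, A e w) (∑ e ∈ s, A' e) ω := by
  intro i j
  simp only [Matrix.sum_apply]
  exact HasDerivAt.fun_sum fun e he => hA e he i j

lemma kronecker_const {A : ℝ → Matrix l n ℂ} {A' : Matrix l n ℂ} {p q : Type*}
    (hA : HasEntrywiseDerivAt A A' ω) (B : Matrix p q ℂ) :
    HasEntrywiseDerivAt (fun w => A w ⊗ₖ B) (A' ⊗ₖ B) ω :=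
  fun i j => (hA i.1 j.1).mul_const (B i.2 j.2)

lemma trace_re {A : ℝ → Matrix m m ℂ} {A' : Matrix m m ℂ} (hA : HasEntrywiseDerivAt A A' ω) :
    HasDerivAt (fun w => (A w).trace.re) A'.trace.re ω :=
  Complex.reCLM.hasFDerivAt.comp_hasDerivAt ω (HasDerivAt.fun_sum fun i _ => hA i i)

lemma dotProduct_mulVec [Fintype l] {A : ℝ → Matrix l m ℂ} {A' : Matrix l m ℂ}
    (hA : HasEntrywiseDerivAt A A' ω) (u : l → ℂ) (v : m → ℂ) :
    HasDerivAt (fun w => u ⬝ᵥ A w *ᵥ v) (u ⬝ᵥ A' *ᵥ v) ω :=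
  HasDerivAt.fun_sum fun i _ =>
    (HasDerivAt.fun_sum fun j _ => (hA i j).mul_const (v j)).const_mul (u i)

lemma isHermitian {A : ℝ → Matrix l l ℂ} {A' : Matrix l l ℂ} (hA : HasEntrywiseDerivAt A A' ω)
    (hAH : ∀ w, (A w).IsHermitian) : A'.IsHermitian := by
  ext i j
  refine (hA.conjTranspose i j).unique ?_
  simpa only [(hAH _).eq] using hA i j

end HasEntrywiseDerivAt

end EntrywiseDerivative

section Trace

variable {n : Type*} [Fintype n] {ρ E L : Matrix n n ℂ}

lemma re_trace_conjTranspose (A : Matrix n n ℂ) : Aᴴ.trace.re = A.trace.re := by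
  rw [Matrix.trace_conjTranspose, Complex.star_def, Complex.conj_re]

lemma re_trace_nonneg (hρ : ρ.PosSemidef) : 0 ≤ ρ.trace.re :=
  (Complex.nonneg_iff.mp hρ.trace_nonneg).1

lemma re_trace_mul_nonneg (hρ : ρ.PosSemidef) (hE : E.PosSemidef) : 0 ≤ (ρ * E).trace.re := by
  classical
  open scoped MatrixOrder in
  obtain ⟨B, rfl⟩ := CStarAlgebra.nonneg_iff_eq_star_mul_self.mp hρ.nonneg
  rw [Matrix.mul_assoc, Matrix.trace_mul_comm]
  exact re_trace_nonneg (hE.mul_mul_conjTranspose_same B)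

lemma re_trace_anticommutator_mul (hρ : ρ.IsHermitian) (hL : L.IsHermitian) (hE : E.IsHermitian) :
    (((1 / 2 : ℂ) • (ρ * L + L * ρ)) * E).trace.re = (ρ * L * E).trace.re := by
  have hconj : (L * ρ * E).trace.re = (ρ * L * E).trace.re := by
    rw [← re_trace_conjTranspose (ρ * L * E), Matrix.conjTranspose_mul, Matrix.conjTranspose_mul,
      hρ.eq, hL.eq, hE.eq, Matrix.trace_mul_comm]
  rw [Matrix.smul_mul, Matrix.add_mul, Matrix.trace_smul, Matrix.trace_add, smul_eq_mul,
    show (1 / 2 : ℂ) = ((1 / 2 : ℝ) : ℂ) by norm_num, Complex.re_ofReal_mul, Complex.add_re, hconj]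
  ring

/-- Cauchy–Schwarz for the form `(X, Y) ↦ Tr (X ρ Yᴴ E)`, applied to `L` and `1`. -/
lemma sq_re_trace_mul_mul_le (hρ : ρ.PosSemidef) (hE : E.PosSemidef) (hL : L.IsHermitian) :
    (ρ * L * E).trace.re ^ 2 ≤ (ρ * E).trace.re * (L * ρ * L * E).trace.re := by
  classical
  have hquad (c : ℝ) : 0 ≤ (ρ * E).trace.re * (c * c) + -2 * (ρ * L * E).trace.re * c
      + (L * ρ * L * E).trace.re := by
    set X := L - (c : ℂ) • (1 : Matrix n n ℂ) with hX
    have hXH : Xᴴ = X := by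
      simp only [hX, Matrix.conjTranspose_sub, hL.eq, Matrix.conjTranspose_smul,
        Matrix.conjTranspose_one, Complex.star_def, Complex.conj_ofReal]
    have hconj := re_trace_anticommutator_mul hρ.isHermitian hL hE.isHermitian
    have hnonneg := re_trace_mul_nonneg (hρ.mul_mul_conjTranspose_same X) hE
    have hexpand : X * ρ * Xᴴ * E = L * ρ * L * E
        - ((2 * c : ℝ) : ℂ) • (((1 / 2 : ℂ) • (ρ * L + L * ρ)) * E)
        + ((c * c : ℝ) : ℂ) • (ρ * E) := by
      rw [hXH, hX]
      simp only [sub_mul, mul_sub, Matrix.smul_mul, Matrix.mul_smul, add_mul, one_mul, mul_one,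
        smul_add, smul_smul]
      push_cast
      module
    rw [hexpand, Matrix.trace_add, Matrix.trace_sub, Matrix.trace_smul, Matrix.trace_smul,
      smul_eq_mul, smul_eq_mul, Complex.add_re, Complex.sub_re, Complex.re_ofReal_mul,
      Complex.re_ofReal_mul, hconj] at hnonneg
    linarith
  have hdiscrim := discrim_le_zero hquad
  rw [discrim] at hdiscrim
  linarith

end Trace

section SLD

lemma exists_isHermitian_diagonal_lyapunov {n : Type*} [Fintype n] [DecidableEq n] {p : n → ℝ}
    (hp : ∀ i, 0 ≤ p i) {R : Matrix n n ℂ} (hR : R.IsHermitian)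
    (hker : ∀ i j, p i = 0 → p j = 0 → R i j = 0) :
    ∃ L : Matrix n n ℂ, L.IsHermitian ∧ R = (1 / 2 : ℂ) •
      (diagonal (fun i => (p i : ℂ)) * L + L * diagonal (fun i => (p i : ℂ))) := by
  refine ⟨Matrix.of fun i j => 2 * R i j / (p i + p j), ?_, ?_⟩
  · ext i j
    simp only [Matrix.conjTranspose_apply, Matrix.of_apply, ← hR.apply i j, star_div₀, star_mul',
      star_add, Complex.star_def, Complex.conj_ofReal, Complex.conj_ofNat]
    rw [add_comm]
  · ext i j
    simp only [Matrix.smul_apply, Matrix.add_apply, Matrix.diagonal_mul, Matrix.mul_diagonal,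
      Matrix.of_apply, smul_eq_mul]
    by_cases hsum : p i + p j = 0
    · rw [hker i j (by linarith [hp i, hp j]) (by linarith [hp i, hp j])]
      simp
    · have hsum' : (p i + p j : ℂ) ≠ 0 := by exact_mod_cast hsum
      field_simp

lemma exists_isHermitian_lyapunov {n : Type*} [Fintype n] {P R : Matrix n n ℂ}
    (hP : P.PosSemidef) (hR : R.IsHermitian)
    (hker : ∀ u v, P *ᵥ u = 0 → P *ᵥ v = 0 → star u ⬝ᵥ R *ᵥ v = 0) :
    ∃ L : Matrix n n ℂ, L.IsHermitian ∧ R = (1 / 2 : ℂ) • (P * L + L * P) := by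
  classical
  have hH := hP.isHermitian
  let V : Matrix n n ℂ := hH.eigenvectorUnitary
  have hVV : Vᴴ * V = 1 := Unitary.coe_star_mul_self hH.eigenvectorUnitary
  have hVV' : V * Vᴴ = 1 := Unitary.coe_mul_star_self hH.eigenvectorUnitary
  have hkerV (i j) (hi : hH.eigenvalues i = 0) (hj : hH.eigenvalues j = 0) :
      (Vᴴ * R * V) i j = 0 := by
    have hcol (k) (hk : hH.eigenvalues k = 0) : P *ᵥ V.col k = 0 := by
      rw [show V.col k = hH.eigenvectorBasis k from rfl, hH.mulVec_eigenvectorBasis, hk, zero_smul]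
    rw [Matrix.mul_assoc, Matrix.mul_apply_eq_vecMul]
    exact hker _ _ (hcol i hi) (hcol j hj)
  obtain ⟨L, hL, hRL⟩ := exists_isHermitian_diagonal_lyapunov hP.eigenvalues_nonneg
    (Matrix.isHermitian_conjTranspose_mul_mul V hR) hkerV
  obtain ⟨D, hD⟩ : ∃ D, D = diagonal fun i => (hH.eigenvalues i : ℂ) := ⟨_, rfl⟩
  have hPD : P = V * D * Vᴴ := hD ▸ hH.spectral_theorem
  rw [← hD] at hRL
  refine ⟨V * L * Vᴴ, Matrix.isHermitian_mul_mul_conjTranspose V hL, ?_⟩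
  calc R = (V * Vᴴ) * R * (V * Vᴴ) := by rw [hVV', Matrix.one_mul, Matrix.mul_one]
    _ = V * (Vᴴ * R * V) * Vᴴ := by simp only [Matrix.mul_assoc]
    _ = (1 / 2 : ℂ) • (V * D * (Vᴴ * V) * L * Vᴴ + V * L * (Vᴴ * V) * D * Vᴴ) := by
      rw [hRL, Matrix.mul_smul, Matrix.smul_mul, Matrix.mul_add, Matrix.add_mul, hVV]
      simp only [Matrix.mul_assoc, Matrix.one_mul]
    _ = (1 / 2 : ℂ) • (P * (V * L * Vᴴ) + V * L * Vᴴ * P) := by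
      rw [hPD]
      simp only [Matrix.mul_assoc]

variable {n : Type} [Fintype n] {ρ : ℝ → Matrix n n ℂ} {ω : ℝ} {R L L' : Matrix n n ℂ}

lemma isSLD_iff (hR : HasEntrywiseDerivAt ρ R ω) :
    IsSLD ρ ω L ↔ L.IsHermitian ∧ R = (1 / 2 : ℂ) • (ρ ω * L + L * ρ ω) := by
  have hderiv : (Matrix.of fun i j => deriv (fun w => ρ w i j) ω) = R := by
    ext i j
    exact (hR i j).deriv
  rw [IsSLD, hderiv]

/-- The value `v† ρ(w) v ≥ 0` is minimal at `w = ω`. -/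
lemma dotProduct_deriv_mulVec_self_eq_zero (hρ : ∀ w, (ρ w).PosSemidef)
    (hR : HasEntrywiseDerivAt ρ R ω) {v : n → ℂ} (hv : ρ ω *ᵥ v = 0) :
    star v ⬝ᵥ R *ᵥ v = 0 := by
  have hform := hR.dotProduct_mulVec (star v) v
  have hmin : IsLocalMin (fun w => (star v ⬝ᵥ ρ w *ᵥ v).re) ω := by
    refine Filter.Eventually.of_forall fun w => ?_
    simpa [hv] using (Complex.nonneg_iff.mp ((hρ w).dotProduct_mulVec_nonneg v)).1
  have hre := hmin.hasDerivAt_eq_zero (Complex.reCLM.hasFDerivAt.comp_hasDerivAt ω hform)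
  have him : HasDerivAt (fun w => (star v ⬝ᵥ ρ w *ᵥ v).im) (star v ⬝ᵥ R *ᵥ v).im ω :=
    Complex.imCLM.hasFDerivAt.comp_hasDerivAt ω hform
  simp only [← (Complex.nonneg_iff.mp ((hρ _).dotProduct_mulVec_nonneg v)).2] at him
  exact Complex.ext hre (him.unique (hasDerivAt_const ω 0))

/-- Polarization of `dotProduct_deriv_mulVec_self_eq_zero`. -/
lemma dotProduct_deriv_mulVec_eq_zero (hρ : ∀ w, (ρ w).PosSemidef)
    (hR : HasEntrywiseDerivAt ρ R ω) {u v : n → ℂ} (hu : ρ ω *ᵥ u = 0) (hv : ρ ω *ᵥ v = 0) :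
    star u ⬝ᵥ R *ᵥ v = 0 := by
  have hdiag (c : ℂ) : star (u + c • v) ⬝ᵥ R *ᵥ (u + c • v) = 0 :=
    dotProduct_deriv_mulVec_self_eq_zero hρ hR (by
      rw [Matrix.mulVec_add, Matrix.mulVec_smul, hu, hv, smul_zero, add_zero])
  have huu := dotProduct_deriv_mulVec_self_eq_zero hρ hR hu
  have hvv := dotProduct_deriv_mulVec_self_eq_zero hρ hR hv
  have hone := hdiag 1
  have hI := hdiag Complex.I
  simp only [star_add, star_smul, Matrix.mulVec_add, Matrix.mulVec_smul, add_dotProduct,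
    dotProduct_add, smul_dotProduct, dotProduct_smul, smul_eq_mul, huu, hvv, Complex.star_def,
    Complex.conj_I, map_one] at hone hI
  linear_combination (1 / 2 : ℂ) * hone - Complex.I / 2 * hI
    + (star u ⬝ᵥ R *ᵥ v - star v ⬝ᵥ R *ᵥ u) / 2 * Complex.I_mul_I

lemma exists_isSLD (hρ : ∀ w, (ρ w).PosSemidef) (hR : HasEntrywiseDerivAt ρ R ω) :
    ∃ L, IsSLD ρ ω L := by
  obtain ⟨L, hL⟩ := exists_isHermitian_lyapunov (hρ ω)
    (hR.isHermitian fun w => (hρ w).isHermitian)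
    fun _ _ hu hv => dotProduct_deriv_mulVec_eq_zero hρ hR hu hv
  exact ⟨L, (isSLD_iff hR).mpr hL⟩

namespace IsSLD

lemma re_trace_eq (hρ : (ρ ω).IsHermitian) (hL : IsSLD ρ ω L) (hL' : IsSLD ρ ω L') :
    (ρ ω * L * L).trace.re = (ρ ω * L' * L').trace.re := by
  have hsame := hL.2.symm.trans hL'.2
  calc (ρ ω * L * L).trace.re = (ρ ω * L' * L).trace.re := by
        rw [← re_trace_anticommutator_mul hρ hL.1 hL.1, hsame,
          re_trace_anticommutator_mul hρ hL'.1 hL.1]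
    _ = (L * L' * ρ ω).trace.re := by
        rw [← re_trace_conjTranspose, Matrix.conjTranspose_mul, Matrix.conjTranspose_mul,
          hρ.eq, hL.1.eq, hL'.1.eq, Matrix.mul_assoc]
    _ = (ρ ω * L * L').trace.re := by rw [Matrix.trace_mul_comm, Matrix.mul_assoc]
    _ = (ρ ω * L' * L').trace.re := by
        rw [← re_trace_anticommutator_mul hρ hL.1 hL'.1, hsame,
          re_trace_anticommutator_mul hρ hL'.1 hL'.1]

lemma qfi_eq (hρ : (ρ ω).IsHermitian) (hL : IsSLD ρ ω L) :
    qfi ρ ω = ENNReal.ofReal (ρ ω * L * L).trace.re :=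
  le_antisymm (iInf₂_le L hL)
    (le_iInf₂ fun _ hL' => (congrArg ENNReal.ofReal (hL.re_trace_eq hρ hL')).le)

end IsSLD

end SLD

section Kraus

variable {ι m : Type*} [Fintype ι] [Fintype m]

/-- The derivatives `K'ₑ - i ∑ₑ' hₑₑ' Kₑ'` of the Kraus operators in the gauge `h`. A Hermitian `h`
generates a rotation of the environment basis, which leaves the channel unchanged; it is chosen to
make these operators small. -/
def gaugedDeriv {n : Type*} (h : Matrix ι ι ℂ) (K K' : ι → Matrix n m ℂ) (e : ι) : Matrix n m ℂ :=
  K' e - Complex.I • ∑ e', h e e' • K e'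

lemma sum_gaugedDeriv_mul_mul_conjTranspose_add {n : Type*} {h : Matrix ι ι ℂ}
    (hh : h.IsHermitian) (K K' : ι → Matrix n m ℂ) (σ : Matrix m m ℂ) :
    ∑ e, (gaugedDeriv h K K' e * σ * (K e)ᴴ + K e * σ * (gaugedDeriv h K K' e)ᴴ)
      = ∑ e, (K' e * σ * (K e)ᴴ + K e * σ * (K' e)ᴴ) := by
  have hswap : ∑ e, K e * σ * (∑ e', h e e' • K e')ᴴ = ∑ e, (∑ e', h e e' • K e') * σ * (K e)ᴴ := by
    simp only [Matrix.conjTranspose_sum, Matrix.conjTranspose_smul, Matrix.mul_sum,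
      Matrix.sum_mul, Matrix.smul_mul, Matrix.mul_smul]
    rw [Finset.sum_comm]
    simp only [hh.apply]
  simp only [gaugedDeriv, Matrix.conjTranspose_sub, Matrix.conjTranspose_smul, Matrix.sub_mul,
    Matrix.mul_sub, Matrix.smul_mul, Matrix.mul_smul, Complex.star_def, Complex.conj_I,
    Finset.sum_add_distrib, Finset.sum_sub_distrib, ← Finset.smul_sum, hswap]
  module

variable {n : Type} [Fintype n]

lemma re_trace_variation_le {σ : Matrix m m ℂ} (hσ : σ.PosSemidef) {L : Matrix n n ℂ}
    (hL : L.IsHermitian) (B K : Matrix n m ℂ) :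
    2 * ((B * σ * Kᴴ + K * σ * Bᴴ) * L).trace.re - (K * σ * Kᴴ * L * L).trace.re
      ≤ 4 * (B * σ * Bᴴ).trace.re := by
  have hnonneg := re_trace_nonneg (hσ.mul_mul_conjTranspose_same ((2 : ℝ) • B - L * K))
  have hexpand : ((2 : ℝ) • B - L * K) * σ * ((2 : ℝ) • B - L * K)ᴴ
      = (4 : ℝ) • (B * σ * Bᴴ) - (2 : ℝ) • (B * σ * Kᴴ * L + L * (K * σ * Bᴴ))
        + L * (K * σ * Kᴴ * L) := by
    simp only [Matrix.conjTranspose_sub, Matrix.conjTranspose_smul, Matrix.conjTranspose_mul,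
      hL.eq, Matrix.sub_mul, Matrix.mul_sub, Matrix.smul_mul, Matrix.mul_smul, Matrix.mul_assoc,
      star_trivial]
    module
  rw [hexpand, Matrix.trace_add, Matrix.trace_sub, Matrix.trace_smul, Matrix.trace_smul,
    Matrix.trace_add, Matrix.trace_mul_comm L, Matrix.trace_mul_comm L] at hnonneg
  simp only [Complex.add_re, Complex.sub_re, Complex.smul_re, smul_eq_mul] at hnonneg
  rw [Matrix.add_mul, Matrix.trace_add, Complex.add_re]
  linarith

lemma qfi_kraus_le {K : ι → ℝ → Matrix n m ℂ} {K' : ι → Matrix n m ℂ} {ω : ℝ}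
    (hK : ∀ e, HasEntrywiseDerivAt (K e) (K' e) ω) {h : Matrix ι ι ℂ} (hh : h.IsHermitian)
    {σ : Matrix m m ℂ} (hσ : σ.PosSemidef) :
    qfi (fun w => ∑ e, K e w * σ * (K e w)ᴴ) ω ≤ ENNReal.ofReal
      (4 * ∑ e, (gaugedDeriv h (K · ω) K' e * σ * (gaugedDeriv h (K · ω) K' e)ᴴ).trace.re) := by
  set ρ : ℝ → Matrix n n ℂ := fun w => ∑ e, K e w * σ * (K e w)ᴴ
  set B := gaugedDeriv h (K · ω) K' with hB
  have hpos (w) : (ρ w).PosSemidef :=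
    Matrix.posSemidef_sum _ fun e _ => hσ.mul_mul_conjTranspose_same (K e w)
  have hderiv : HasEntrywiseDerivAt ρ (∑ e, (B e * σ * (K e ω)ᴴ + K e ω * σ * (B e)ᴴ)) ω := by
    rw [hB, sum_gaugedDeriv_mul_mul_conjTranspose_add hh]
    refine HasEntrywiseDerivAt.sum fun e _ => ?_
    simpa using ((hK e).mul (.const σ)).mul (hK e).conjTranspose
  obtain ⟨L, hL⟩ := exists_isSLD hpos hderiv
  rw [hL.qfi_eq (hpos ω).isHermitian]
  refine ENNReal.ofReal_le_ofReal ?_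
  obtain ⟨hLH, hR⟩ := (isSLD_iff hderiv).mp hL
  have hinfo : ((∑ e, (B e * σ * (K e ω)ᴴ + K e ω * σ * (B e)ᴴ)) * L).trace.re
      = (ρ ω * L * L).trace.re := by
    rw [hR, re_trace_anticommutator_mul (hpos ω).isHermitian hLH hLH]
  have hsum := Finset.sum_le_sum fun e (_ : e ∈ Finset.univ) =>
    re_trace_variation_le hσ hLH (B e) (K e ω)
  rw [Finset.sum_sub_distrib, ← Finset.mul_sum, ← Finset.mul_sum] at hsum
  simp only [← Complex.re_sum, ← Matrix.trace_sum, ← Finset.sum_mul] at hsum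
  rw [hinfo] at hsum
  rw [← Complex.re_sum, ← Matrix.trace_sum]
  linarith

end Kraus

section Evolution

/-- The Kraus operators `⟨e|_E exp(-i t H) |0⟩_E` of the channel that the free evolution induces on
the system. -/
noncomputable def kraus (g ω t : ℝ) (e : Fin 2) : Matrix (Fin 2) (Fin 2) ℂ :=
  Matrix.of fun s s' => evolution g ω t (s, e) (s', 0)

lemma isHermitian_hamiltonian (g ω : ℝ) : (hamiltonian g ω).IsHermitian := by
  ext ⟨s, e⟩ ⟨s', e'⟩
  fin_cases s <;> fin_cases e <;> fin_cases s' <;> fin_cases e' <;>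
    simp [hamiltonian, pauliZ, swapGate]

lemma conjTranspose_evolution_mul_self (g ω t : ℝ) :
    (evolution g ω t)ᴴ * evolution g ω t = 1 := by
  have hadj : (evolution g ω t)ᴴ =
      NormedSpace.exp (-((-(Complex.I * (t : ℂ))) • hamiltonian g ω)) := by
    rw [evolution, ← Matrix.exp_conjTranspose, Matrix.conjTranspose_smul,
      (isHermitian_hamiltonian g ω).eq]
    simp
  rw [hadj, Matrix.exp_neg, evolution]
  exact Matrix.nonsing_inv_mul _ ((Matrix.isUnit_iff_isUnit_det _).mp (Matrix.isUnit_exp _))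

lemma sum_conjTranspose_kraus_mul_kraus (g ω t : ℝ) :
    ∑ e, (kraus g ω t e)ᴴ * kraus g ω t e = 1 := by
  ext s s'
  have hentry := congrFun₂ (conjTranspose_evolution_mul_self g ω t) (s, 0) (s', 0)
  simp only [Matrix.mul_apply, Matrix.conjTranspose_apply, Fintype.sum_prod_type,
    Matrix.one_apply, Prod.mk.injEq, and_true] at hentry
  simp only [kraus, Matrix.sum_apply, Matrix.mul_apply, Matrix.conjTranspose_apply,
    Matrix.of_apply, Matrix.one_apply]
  rw [Finset.sum_comm, hentry]

open scoped Matrix.Norms.Operator in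
lemma exists_hasEntrywiseDerivAt_kraus (g ω t : ℝ) (e : Fin 2) :
    ∃ K', HasEntrywiseDerivAt (fun w => kraus g w t e) K' ω := by
  have hham : DifferentiableAt ℝ (fun w => (-(Complex.I * (t : ℂ))) • hamiltonian g w) ω := by
    unfold hamiltonian
    fun_prop
  have hevol : DifferentiableAt ℝ (fun w => evolution g w t) ω :=
    (NormedSpace.exp_analytic (𝕂 := ℝ) _).differentiableAt.comp ω hham
  have hentry (p q : Fin 2 × Fin 2) : DifferentiableAt ℝ (fun w => evolution g w t p q) ω :=
    (Matrix.entryLinearMap ℝ ℂ p q).toContinuousLinearMap.differentiableAt.comp ω hevol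
  exact ⟨Matrix.of fun s s' => _, fun s s' => (hentry (s, e) (s', 0)).hasDerivAt⟩

lemma sum_trace_kronecker_one_conj {ι n a : Type*} [Fintype ι] [Fintype n] [Fintype a]
    [DecidableEq a] (B : ι → Matrix n n ℂ) (σ : Matrix (n × a) (n × a) ℂ) :
    ∑ e, ((B e ⊗ₖ (1 : Matrix a a ℂ)) * σ * (B e ⊗ₖ (1 : Matrix a a ℂ))ᴴ).trace
      = (((∑ e, (B e)ᴴ * B e) ⊗ₖ (1 : Matrix a a ℂ)) * σ).trace := by
  have hsum : (∑ e, (B e)ᴴ * B e) ⊗ₖ (1 : Matrix a a ℂ)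
      = ∑ e, ((B e)ᴴ * B e) ⊗ₖ (1 : Matrix a a ℂ) := by
    ext i j
    simp only [Matrix.kroneckerMap_apply, Matrix.sum_apply, Finset.sum_mul]
  rw [hsum, Finset.sum_mul, Matrix.trace_sum]
  refine Finset.sum_congr rfl fun e _ => ?_
  rw [Matrix.trace_mul_comm, ← Matrix.mul_assoc, Matrix.conjTranspose_kronecker,
    Matrix.conjTranspose_one, ← Matrix.mul_kronecker_mul, Matrix.one_mul]

variable {d : ℕ} (ρ : DensityMatrix (Fin 2 × Fin d))

lemma finalState_eq_sum_kraus (g ω t : ℝ) :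
    finalState g ω t ρ = ∑ e, (kraus g ω t e ⊗ₖ (1 : Matrix (Fin d) (Fin d) ℂ)) * ρ.mat *
      (kraus g ω t e ⊗ₖ (1 : Matrix (Fin d) (Fin d) ℂ))ᴴ := by
  ext ⟨s, a⟩ ⟨s', a'⟩
  simp only [finalState, traceEnv, adjoinEnv, Matrix.of_apply, Matrix.sum_apply, Matrix.mul_apply,
    Matrix.conjTranspose_apply, Matrix.kroneckerMap_apply, Fintype.sum_prod_type, kraus]
  refine Finset.sum_congr rfl fun e _ => ?_
  simp [ite_and]

lemma posSemidef_finalState (g ω t : ℝ) : (finalState g ω t ρ).PosSemidef := by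
  rw [finalState_eq_sum_kraus]
  exact Matrix.posSemidef_sum _ fun e _ => ρ.posSemidef.mul_mul_conjTranspose_same _

lemma trace_finalState (g ω t : ℝ) : (finalState g ω t ρ).trace = 1 := by
  rw [finalState_eq_sum_kraus, Matrix.trace_sum, sum_trace_kronecker_one_conj,
    sum_conjTranspose_kraus_mul_kraus, Matrix.one_kronecker_one, Matrix.one_mul, ρ.trace_eq_one]

lemma exists_hasEntrywiseDerivAt_finalState (g ω t : ℝ) :
    ∃ R, HasEntrywiseDerivAt (fun w => finalState g w t ρ) R ω := by
  choose K' hK' using exists_hasEntrywiseDerivAt_kraus g ω t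
  simp only [finalState_eq_sum_kraus]
  have hkron (e) := (hK' e).kronecker_const (1 : Matrix (Fin d) (Fin d) ℂ)
  exact ⟨_, HasEntrywiseDerivAt.sum fun e _ =>
    ((hkron e).mul (.const ρ.mat)).mul (hkron e).conjTranspose⟩

lemma gaugedDeriv_kronecker {ι l m p q : Type*} [Fintype ι] (h : Matrix ι ι ℂ)
    (K K' : ι → Matrix l m ℂ) (C : Matrix p q ℂ) (e : ι) :
    gaugedDeriv h (fun e => K e ⊗ₖ C) (fun e => K' e ⊗ₖ C) e = gaugedDeriv h K K' e ⊗ₖ C := by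
  ext i j
  simp only [gaugedDeriv, Matrix.sub_apply, Matrix.smul_apply, Matrix.sum_apply,
    Matrix.kroneckerMap_apply, smul_eq_mul, sub_mul, mul_assoc, Finset.sum_mul]

lemma qfiFE_le {g ω t M : ℝ} {K' : Fin 2 → Matrix (Fin 2) (Fin 2) ℂ}
    (hK : ∀ e, HasEntrywiseDerivAt (fun w => kraus g w t e) (K' e) ω)
    {h : Matrix (Fin 2) (Fin 2) ℂ} (hh : h.IsHermitian)
    (hM : ((M : ℂ) • 1 - ∑ e, (gaugedDeriv h (kraus g ω t) K' e)ᴴ *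
      gaugedDeriv h (kraus g ω t) K' e).PosSemidef) :
    qfiFE g ω t ≤ ENNReal.ofReal (4 * M) := by
  refine iSup₂_le fun d ρ => ?_
  set G := ∑ e, (gaugedDeriv h (kraus g ω t) K' e)ᴴ * gaugedDeriv h (kraus g ω t) K' e with hG
  have hsplit : ((M : ℂ) • 1 - G) ⊗ₖ (1 : Matrix (Fin d) (Fin d) ℂ) * ρ.mat
      = (M : ℂ) • ρ.mat - G ⊗ₖ (1 : Matrix (Fin d) (Fin d) ℂ) * ρ.mat := by
    rw [eq_sub_iff_add_eq, ← Matrix.add_mul, ← Matrix.add_kronecker, sub_add_cancel,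
      Matrix.smul_kronecker, Matrix.one_kronecker_one, Matrix.smul_mul, Matrix.one_mul]
  have hpos := re_trace_mul_nonneg (hM.kronecker (Matrix.PosSemidef.one (n := Fin d)))
    ρ.posSemidef
  rw [hsplit, Matrix.trace_sub, hG, ← sum_trace_kronecker_one_conj, Matrix.trace_smul,
    ρ.trace_eq_one, smul_eq_mul, mul_one, Complex.sub_re, Complex.ofReal_re,
    Complex.re_sum] at hpos
  simp only [finalState_eq_sum_kraus]
  refine (qfi_kraus_le (fun e => (hK e).kronecker_const 1) hh ρ.posSemidef).trans
    (ENNReal.ofReal_le_ofReal ?_)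
  simp only [gaugedDeriv_kronecker]
  linarith

end Evolution

section MatrixExponential

variable {n : Type*} [Fintype n] [DecidableEq n] {M : Matrix n n ℂ} {u v : n → ℂ} {c s z : ℂ}

lemma pow_mulVec_of_mulVec_eq_smul (hv : M *ᵥ v = z • v) (k : ℕ) : M ^ k *ᵥ v = z ^ k • v := by
  induction k with
  | zero => simp
  | succ k ih =>
    rw [pow_succ, ← Matrix.mulVec_mulVec, hv, Matrix.mulVec_smul, ih, smul_smul, pow_succ, mul_comm]

open scoped Matrix.Norms.Operator in
lemma exp_mulVec_of_mulVec_eq_smul (hv : M *ᵥ v = z • v) :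
    NormedSpace.exp M *ᵥ v = Complex.exp z • v := by
  have hM : HasSum (fun k : ℕ => ((k.factorial : ℂ)⁻¹ • M ^ k) *ᵥ v) (NormedSpace.exp M *ᵥ v) :=
    (NormedSpace.exp_series_hasSum_exp' (𝕂 := ℂ) M).map
      (AddMonoidHom.mk' (· *ᵥ v) fun X Y => Matrix.add_mulVec X Y v)
      (continuous_id.matrix_mulVec continuous_const)
  have hz : HasSum (fun k : ℕ => ((k.factorial : ℂ)⁻¹ • z ^ k) • v) (Complex.exp z • v) := by
    rw [Complex.exp_eq_exp_ℂ]
    exact (NormedSpace.exp_series_hasSum_exp' (𝕂 := ℂ) z).smul_const v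
  refine hM.unique (hz.congr_fun fun k => ?_)
  rw [Matrix.smul_mulVec, pow_mulVec_of_mulVec_eq_smul hv, smul_assoc]

/-- The vectors `s v ± u` are eigenvectors with eigenvalues `c ± s`. -/
lemma exp_smul_mulVec_of_invariant_pair (hs : s ≠ 0) (hv : M *ᵥ v = c • v + u)
    (hu : M *ᵥ u = c • u + s ^ 2 • v) (z : ℂ) :
    NormedSpace.exp (z • M) *ᵥ v
      = Complex.exp (z * c) • (Complex.cosh (z * s) • v + (Complex.sinh (z * s) / s) • u) := by
  have heigen (r : ℂ) (hr : r ^ 2 = s ^ 2) :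
      NormedSpace.exp (z • M) *ᵥ (r • v + u) = Complex.exp (z * (c + r)) • (r • v + u) := by
    refine exp_mulVec_of_mulVec_eq_smul ?_
    rw [Matrix.smul_mulVec, Matrix.mulVec_add, Matrix.mulVec_smul, hv, hu, ← hr]
    module
  have hplus := heigen s rfl
  have hminus := heigen (-s) (neg_sq s)
  have hdecomp : v = (1 / (2 * s)) • ((s • v + u) - (-s • v + u)) := by
    rw [add_sub_add_right_eq_sub, ← sub_smul, smul_smul]
    field_simp
    norm_num
  conv_lhs => rw [hdecomp, Matrix.mulVec_smul, Matrix.mulVec_sub, hplus, hminus]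
  rw [mul_add, mul_add, mul_neg, Complex.exp_add, Complex.exp_add, Complex.cosh, Complex.sinh]
  match_scalars <;> field_simp
  ring

end MatrixExponential

section ExplicitKraus

/-- The Kraus operators of a channel that multiplies `|0⟩` by the phase `φ`, keeps the amplitude `a`
of `|1⟩`, and lets `|1⟩` decay to `|0⟩` with the amplitude `β`. -/
def dampingKraus (φ a β : ℂ) : Fin 2 → Matrix (Fin 2) (Fin 2) ℂ :=
  ![!![φ, 0; 0, a], !![0, β; 0, 0]]

lemma hamiltonian_mulVec_single_zero_zero (g ω : ℝ) :
    hamiltonian g ω *ᵥ Pi.single (0, 0) 1 = ((1 + g + ω / 2 : ℝ) : ℂ) • Pi.single (0, 0) 1 := by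
  ext ⟨s, e⟩
  fin_cases s <;> fin_cases e <;> simp [hamiltonian, pauliZ, swapGate]
  ring

lemma hamiltonian_mulVec_single_one_zero (g ω : ℝ) :
    hamiltonian g ω *ᵥ Pi.single (1, 0) 1 = (1 : ℂ) • Pi.single (1, 0) 1 +
      ((-(ω / 2) : ℂ) • Pi.single (1, 0) 1 + (g : ℂ) • Pi.single (0, 1) 1) := by
  ext ⟨s, e⟩
  fin_cases s <;> fin_cases e <;> simp [hamiltonian, pauliZ, swapGate]
  ring

lemma hamiltonian_mulVec_single_zero_one (g ω : ℝ) :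
    hamiltonian g ω *ᵥ Pi.single (0, 1) 1 = (1 : ℂ) • Pi.single (0, 1) 1 +
      ((ω / 2 : ℂ) • Pi.single (0, 1) 1 + (g : ℂ) • Pi.single (1, 0) 1) := by
  ext ⟨s, e⟩
  fin_cases s <;> fin_cases e <;> simp [hamiltonian, pauliZ, swapGate]
  ring

variable {g ω : ℝ}

lemma rabi_sq (g ω : ℝ) : rabi g ω ^ 2 = g ^ 2 + ω ^ 2 / 4 := Real.sq_sqrt (by positivity)

lemma rabi_pos (hg : g ≠ 0) (ω : ℝ) : 0 < rabi g ω := Real.sqrt_pos.mpr (by positivity)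

lemma kraus_eq_dampingKraus {t : ℝ} {φ a β : ℂ}
    (h₀ : evolution g ω t *ᵥ Pi.single (0, 0) 1 = φ • Pi.single (0, 0) 1)
    (h₁ : evolution g ω t *ᵥ Pi.single (1, 0) 1
      = a • Pi.single (1, 0) 1 + β • Pi.single (0, 1) 1) :
    kraus g ω t = dampingKraus φ a β := by
  rw [Matrix.mulVec_single_one] at h₀ h₁
  funext e
  ext s s'
  fin_cases s'
  · have hentry := congrFun h₀ (s, e)
    fin_cases e <;> fin_cases s <;> simpa [kraus, dampingKraus] using hentry
  · have hentry := congrFun h₁ (s, e)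
    fin_cases e <;> fin_cases s <;> simpa [kraus, dampingKraus] using hentry

lemma evolution_mulVec_single_zero_zero (g ω t : ℝ) :
    evolution g ω t *ᵥ Pi.single (0, 0) 1
      = Complex.exp (-(Complex.I * t) * (1 + g + ω / 2 : ℝ)) • Pi.single (0, 0) 1 := by
  refine exp_mulVec_of_mulVec_eq_smul ?_
  rw [Matrix.smul_mulVec, hamiltonian_mulVec_single_zero_zero, smul_smul]

lemma kraus_zero_coupling (ω t : ℝ) :
    kraus 0 ω t = dampingKraus (Complex.exp (-(Complex.I * t) * (1 + ω / 2 : ℝ)))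
      (Complex.exp (-(Complex.I * t) * (1 - ω / 2 : ℝ))) 0 := by
  refine kraus_eq_dampingKraus ?_ ?_
  · simpa using evolution_mulVec_single_zero_zero 0 ω t
  · rw [zero_smul, add_zero]
    refine exp_mulVec_of_mulVec_eq_smul ?_
    rw [Matrix.smul_mulVec, hamiltonian_mulVec_single_one_zero]
    push_cast
    module

/-- In the invariant plane of `|10⟩` and `|01⟩`, the operator `H - 1` squares to `Ω²`. -/
lemma kraus_of_coupling_ne_zero (hg : g ≠ 0) (ω t : ℝ) :
    kraus g ω t = dampingKraus (Complex.exp (-(Complex.I * t) * (1 + g + ω / 2 : ℝ)))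
      (Complex.exp (-(Complex.I * t)) * (Real.cos (rabi g ω * t)
        + (ω / 2 * (Real.sin (rabi g ω * t) / rabi g ω) : ℝ) * Complex.I))
      (Complex.exp (-(Complex.I * t)) *
        ((-g * (Real.sin (rabi g ω * t) / rabi g ω) : ℝ) * Complex.I)) := by
  refine kraus_eq_dampingKraus (evolution_mulVec_single_zero_zero g ω t) ?_
  have hΩ : (rabi g ω : ℂ) ≠ 0 := by exact_mod_cast (rabi_pos hg ω).ne'
  have hΩsq : (rabi g ω : ℂ) ^ 2 = g ^ 2 + ω ^ 2 / 4 := by exact_mod_cast rabi_sq g ω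
  have harg : -(Complex.I * t) * rabi g ω = -((rabi g ω * t : ℝ) : ℂ) * Complex.I := by
    push_cast
    ring
  rw [evolution, exp_smul_mulVec_of_invariant_pair hΩ (hamiltonian_mulVec_single_one_zero g ω) ?_,
    harg, Complex.cosh_mul_I, Complex.sinh_mul_I, Complex.cos_neg, Complex.sin_neg, mul_one,
    Complex.ofReal_cos]
  · push_cast
    module
  · rw [Matrix.mulVec_add, Matrix.mulVec_smul, Matrix.mulVec_smul,
      hamiltonian_mulVec_single_one_zero, hamiltonian_mulVec_single_zero_one, hΩsq]
    module

lemma gaugedDeriv_dampingKraus (x : ℝ) (φ a β φ' a' β' : ℂ) :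
    gaugedDeriv (diagonal ![-(x : ℂ), 0]) (dampingKraus φ a β) (dampingKraus φ' a' β')
      = dampingKraus (φ' + Complex.I * x * φ) (a' + Complex.I * x * a) β' := by
  funext e
  ext s s'
  fin_cases e <;> fin_cases s <;> fin_cases s' <;>
    simp [gaugedDeriv, dampingKraus, mul_assoc]

lemma sum_conjTranspose_dampingKraus_mul (φ a β : ℂ) :
    ∑ e, (dampingKraus φ a β e)ᴴ * dampingKraus φ a β e
      = diagonal ![((‖φ‖ ^ 2 : ℝ) : ℂ), ((‖a‖ ^ 2 + ‖β‖ ^ 2 : ℝ) : ℂ)] := by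
  ext s s'
  fin_cases s <;> fin_cases s' <;>
    simp [dampingKraus, Matrix.mul_apply, Fin.sum_univ_two, ← Complex.conj_mul']

lemma qfiFE_le_of_dampingKraus {t x M : ℝ} {φ a β : ℝ → ℂ} {φ' a' β' : ℂ}
    (hK : ∀ w, kraus g w t = dampingKraus (φ w) (a w) (β w)) (hφ : HasDerivAt φ φ' ω)
    (ha : HasDerivAt a a' ω) (hβ : HasDerivAt β β' ω)
    (hzero : ‖φ' + Complex.I * x * φ ω‖ ^ 2 ≤ M)
    (hone : ‖a' + Complex.I * x * a ω‖ ^ 2 + ‖β'‖ ^ 2 ≤ M) :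
    qfiFE g ω t ≤ ENNReal.ofReal (4 * M) := by
  have hderiv (e) : HasEntrywiseDerivAt (fun w => kraus g w t e) (dampingKraus φ' a' β' e) ω := by
    simp only [hK]
    intro s s'
    fin_cases e <;> fin_cases s <;> fin_cases s' <;>
      first | assumption | exact hasDerivAt_const ω (0 : ℂ)
  have hherm : (diagonal ![-(x : ℂ), 0]).IsHermitian := by
    rw [Matrix.isHermitian_diagonal_iff]
    intro i
    fin_cases i <;> simp [isSelfAdjoint_iff]
  refine qfiFE_le hderiv hherm ?_
  rw [hK, gaugedDeriv_dampingKraus, sum_conjTranspose_dampingKraus_mul, Matrix.smul_one_eq_diagonal,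
    Matrix.diagonal_sub, Matrix.posSemidef_diagonal_iff]
  intro i
  fin_cases i
  · exact sub_nonneg.mpr (Complex.real_le_real.mpr hzero)
  · exact sub_nonneg.mpr (Complex.real_le_real.mpr hone)

end ExplicitKraus

section QFIBound

variable {g ω : ℝ}

lemma hasDerivAt_rabi (hg : g ≠ 0) (ω : ℝ) : HasDerivAt (rabi g) (ω / (4 * rabi g ω)) ω := by
  have hsq : HasDerivAt (fun w : ℝ => g ^ 2 + w ^ 2 / 4) (ω / 2) ω :=
    (((hasDerivAt_pow 2 ω).div_const 4).const_add (g ^ 2)).congr_deriv (by norm_num; ring)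
  exact (hsq.sqrt (by positivity)).congr_deriv
    (show ω / 2 / (2 * rabi g ω) = ω / (4 * rabi g ω) by ring)

lemma hasDerivAt_cos_rabi_mul (hg : g ≠ 0) (ω t : ℝ) :
    HasDerivAt (fun w => Real.cos (rabi g w * t))
      (-(ω * t / 4) * (Real.sin (rabi g ω * t) / rabi g ω)) ω :=
  ((hasDerivAt_rabi hg ω).mul_const t).cos.congr_deriv (by ring)

lemma hasDerivAt_sin_rabi_mul_div (hg : g ≠ 0) (ω t : ℝ) :
    HasDerivAt (fun w => Real.sin (rabi g w * t) / rabi g w)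
      (ω / (4 * rabi g ω ^ 2) * (t * Real.cos (rabi g ω * t) - Real.sin (rabi g ω * t) / rabi g ω))
      ω := by
  have hΩ := (rabi_pos hg ω).ne'
  exact (((hasDerivAt_rabi hg ω).mul_const t).sin.div (hasDerivAt_rabi hg ω) hΩ).congr_deriv
    (by field_simp)

lemma norm_sq_exp_mul {z : ℂ} (hz : z.re = 0) (X Y : ℝ) :
    ‖Complex.exp z * (X + Y * Complex.I)‖ ^ 2 = X ^ 2 + Y ^ 2 := by
  rw [norm_mul, Complex.norm_exp, hz, Real.exp_zero, one_mul, Complex.sq_norm,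
    Complex.normSq_add_mul_I]

lemma norm_sq_gauged_exp {z : ℂ} (hz : z.re = 0) (t y : ℝ) :
    ‖Complex.exp z * (-(Complex.I * t) * (1 / 2 : ℝ)) +
      Complex.I * (t / 2 - y : ℝ) * Complex.exp z‖ ^ 2 = y ^ 2 := by
  trans 0 ^ 2 + (-y) ^ 2
  · rw [← norm_sq_exp_mul hz]
    congr 2
    push_cast
    ring
  · ring

lemma gauged_norm_sq_identity {Ω c u : ℝ} (hΩ : Ω ≠ 0) (hΩsq : Ω ^ 2 = g ^ 2 + ω ^ 2 / 4)
    (hcu : (Ω * u) ^ 2 + c ^ 2 = 1) (t y : ℝ) :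
    4 * (y ^ 2 + ((-(ω * u / 2) * (t - y)) ^ 2
        + ((u + ω * (ω / (4 * Ω ^ 2) * (t * c - u))) / 2 + (t / 2 - y) * c) ^ 2
        + (g * (ω / (4 * Ω ^ 2) * (t * c - u))) ^ 2))
      = 4 * y ^ 2 + g ^ 2 / Ω ^ 2 * (t * c + u - 2 * c * y) ^ 2 + ω ^ 2 / Ω ^ 2 * (t - y) ^ 2 := by
  have hY : (u + ω * (ω / (4 * Ω ^ 2) * (t * c - u))) / 2 + (t / 2 - y) * c
      = c * (t - y) - g ^ 2 / (2 * Ω ^ 2) * (t * c - u) := by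
    field_simp
    linear_combination -(4 * (t * c - u)) * hΩsq
  rw [hY]
  field_simp
  linear_combination (64 * Ω ^ 2 * c ^ 2 * (t - y) ^ 2 - 16 * g ^ 2 * (t * c - u) ^ 2) * hΩsq
    + 16 * Ω ^ 2 * ω ^ 2 * (t - y) ^ 2 * hcu

/-- Uses the gauge `diag(y - t/2, 0)`. -/
lemma qfiFE_le_of_coupling_ne_zero (hg : g ≠ 0) (ω t y : ℝ) :
    qfiFE g ω t ≤ ENNReal.ofReal (4 * y ^ 2
      + g ^ 2 / rabi g ω ^ 2 * (t * Real.cos (rabi g ω * t) + Real.sin (rabi g ω * t) / rabi g ω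
          - 2 * Real.cos (rabi g ω * t) * y) ^ 2
      + ω ^ 2 / rabi g ω ^ 2 * (t - y) ^ 2) := by
  have hcos := hasDerivAt_cos_rabi_mul hg ω t
  have hsin := hasDerivAt_sin_rabi_mul_div hg ω t
  have hΩ := rabi_pos hg ω
  have hφ : HasDerivAt (fun w : ℝ => Complex.exp (-(Complex.I * t) * (1 + g + w / 2 : ℝ)))
      (Complex.exp (-(Complex.I * t) * (1 + g + ω / 2 : ℝ)) * (-(Complex.I * t) * (1 / 2 : ℝ)))
      ω :=
    ((((hasDerivAt_id ω).div_const 2).const_add (1 + g)).ofReal_comp.const_mul _).cexp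
  have ha := (hcos.ofReal_comp.fun_add ((((hasDerivAt_id' ω).div_const 2).fun_mul
    hsin).ofReal_comp.mul_const Complex.I)).const_mul (Complex.exp (-(Complex.I * t)))
  have hβ := ((hsin.const_mul (-g)).ofReal_comp.mul_const Complex.I).const_mul
    (Complex.exp (-(Complex.I * t)))
  set c := Real.cos (rabi g ω * t)
  set u := Real.sin (rabi g ω * t) / rabi g ω with hu
  set k := ω / (4 * rabi g ω ^ 2) * (t * c - u)
  have hone : ‖Complex.exp (-(Complex.I * t)) * ((-(ω * t / 4) * u : ℝ) +
        (1 / 2 * u + ω / 2 * k : ℝ) * Complex.I) + Complex.I * (t / 2 - y : ℝ) *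
          (Complex.exp (-(Complex.I * t)) * (c + (ω / 2 * u : ℝ) * Complex.I))‖ ^ 2
      = (-(ω * u / 2) * (t - y)) ^ 2 + ((u + ω * k) / 2 + (t / 2 - y) * c) ^ 2 := by
    rw [← norm_sq_exp_mul (z := -(Complex.I * t)) (by simp)]
    congr 2
    push_cast
    linear_combination Complex.exp (-(Complex.I * t)) * (t / 2 - y) * (ω / 2 * u) * Complex.I_sq
  have hdecay : ‖Complex.exp (-(Complex.I * t)) * ((-g * k : ℝ) * Complex.I)‖ ^ 2
      = (g * k) ^ 2 := by
    simpa [neg_sq] using norm_sq_exp_mul (z := -(Complex.I * t)) (by simp) 0 (-g * k)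
  refine (qfiFE_le_of_dampingKraus (kraus_of_coupling_ne_zero hg · t) hφ ha hβ
    ((norm_sq_gauged_exp (by simp) t y).le.trans (le_add_of_nonneg_right (by positivity)))
    ((congrArg₂ (· + ·) hone hdecay).le.trans (le_add_of_nonneg_left (sq_nonneg y)))).trans
    (ENNReal.ofReal_le_ofReal (gauged_norm_sq_identity hΩ.ne' (rabi_sq g ω) ?_ t y).le)
  rw [hu, mul_div_cancel₀ _ hΩ.ne', Real.sin_sq_add_cos_sq]

end QFIBound

section StrongCouplingBounds

variable {g : ℝ}

lemma le_rabi (g ω : ℝ) : g ≤ rabi g ω :=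
  Real.le_sqrt_of_sq_le (by nlinarith [sq_nonneg ω])

lemma rabi_div_sub_one_le (hg : 0 < g) (ω : ℝ) : rabi g ω / g - 1 ≤ ω ^ 2 / (8 * g ^ 2) := by
  have hsqrt : rabi g ω ≤ g + ω ^ 2 / (8 * g) := by
    refine Real.sqrt_le_iff.mpr ⟨by positivity, ?_⟩
    have hcross : 2 * g * (ω ^ 2 / (8 * g)) = ω ^ 2 / 4 := by
      field_simp
      ring
    nlinarith [sq_nonneg (ω ^ 2 / (8 * g))]
  calc rabi g ω / g - 1 ≤ (g + ω ^ 2 / (8 * g)) / g - 1 := by gcongr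
    _ = ω ^ 2 / (8 * g ^ 2) := by
      field_simp
      ring

lemma sq_div_rabi_sq_le (hg : 0 < g) (ω x : ℝ) : x ^ 2 / rabi g ω ^ 2 ≤ x ^ 2 / g ^ 2 := by
  have hΩ := le_rabi g ω
  gcongr

lemma abs_sin_mul_div_le {Ω : ℝ} (hΩ : 0 < Ω) (t : ℝ) : |Real.sin (Ω * t) / Ω| ≤ |t| := by
  rw [abs_div, abs_of_pos hΩ, div_le_iff₀ hΩ]
  calc |Real.sin (Ω * t)| ≤ |Ω * t| := Real.abs_sin_le_abs
    _ = |t| * Ω := by rw [abs_mul, abs_of_pos hΩ, mul_comm]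

lemma sq_mul_cos_add_sin_div_rabi_le (hg : 0 < g) (ω t : ℝ) :
    (t * Real.cos (rabi g ω * t) + Real.sin (rabi g ω * t) / rabi g ω) ^ 2
      ≤ (t * Real.cos (rabi g ω * t) + Real.sin (rabi g ω * t) / g) ^ 2
        + ω ^ 2 * t ^ 2 / (4 * g ^ 2) := by
  have hΩ := rabi_pos hg.ne' ω
  have hcos := Real.abs_cos_le_one (rabi g ω * t)
  have hu := abs_sin_mul_div_le hΩ t
  set c := Real.cos (rabi g ω * t)
  set u := Real.sin (rabi g ω * t) / rabi g ω with hu_def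
  set r := rabi g ω / g - 1 with hr
  have hv : Real.sin (rabi g ω * t) / g = u * (1 + r) := by
    rw [hu_def, hr]
    field_simp
    ring
  have hr_nonneg : 0 ≤ r := sub_nonneg.mpr ((one_le_div hg).mpr (le_rabi g ω))
  have hcross : |t * c * u| ≤ t ^ 2 := by
    rw [abs_mul, abs_mul, ← sq_abs t, sq]
    calc |t| * |c| * |u| ≤ |t| * 1 * |t| := by gcongr
      _ = |t| * |t| := by ring
  calc (t * c + u) ^ 2
      = (t * c + u * (1 + r)) ^ 2 - 2 * r * (t * c * u) - u ^ 2 * r * (2 + r) := by ring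
    _ ≤ (t * c + u * (1 + r)) ^ 2 + 2 * r * t ^ 2 - 0 := by
      have hle := mul_le_mul_of_nonneg_left ((neg_le_abs _).trans hcross) hr_nonneg
      have hpos : 0 ≤ u ^ 2 * r * (2 + r) := by positivity
      linarith
    _ ≤ (t * c + u * (1 + r)) ^ 2 + 2 * (ω ^ 2 / (8 * g ^ 2)) * t ^ 2 - 0 := by
      gcongr
      exact rabi_div_sub_one_le hg ω
    _ = _ := by
      rw [hv]
      ring

lemma two_div_cos_two_mul_add_three (x : ℝ) :
    2 / (Real.cos (2 * x) + 3) = 1 / (1 + Real.cos x ^ 2) := by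
  rw [Real.cos_two_mul, show 2 * Real.cos x ^ 2 - 1 + 3 = 2 * (1 + Real.cos x ^ 2) by ring]
  field_simp

lemma sq_mul_cos_div_cos_two_mul_add_three (Ω T x : ℝ) :
    2 * T ^ 2 * x ^ 2 * Real.cos (T * Ω * x) ^ 2 / (Real.cos (2 * T * x * Ω) + 3)
      = (T * x * Real.cos (Ω * (T * x))) ^ 2 / (1 + Real.cos (Ω * (T * x)) ^ 2) := by
  rw [show 2 * T * x * Ω = 2 * (Ω * (T * x)) by ring, show T * Ω * x = Ω * (T * x) by ring]
  linear_combination (T * x * Real.cos (Ω * (T * x))) ^ 2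
    * two_div_cos_two_mul_add_three (Ω * (T * x))

lemma exists_optimal_gauge {t h : ℝ} (hth : |h| ≤ 2 * |t|) (c : ℝ) :
    ∃ y, 4 * y ^ 2 + (h - 2 * c * y) ^ 2 = h ^ 2 / (1 + c ^ 2) ∧ (t - y) ^ 2 ≤ (3 / 2 * t) ^ 2 := by
  have hc : |c / (2 * (1 + c ^ 2))| ≤ 1 / 4 := by
    rw [abs_div, abs_of_pos (by positivity : 0 < 2 * (1 + c ^ 2)), div_le_iff₀ (by positivity)]
    nlinarith [sq_nonneg (|c| - 1), sq_abs c]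
  refine ⟨c / (2 * (1 + c ^ 2)) * h, ?_, sq_le_sq.mpr ?_⟩
  · field_simp
    ring
  · calc |t - c / (2 * (1 + c ^ 2)) * h| ≤ |t| + |c / (2 * (1 + c ^ 2))| * |h| := by
          rw [← abs_mul]
          exact abs_sub _ _
      _ ≤ |t| + 1 / 4 * (2 * |t|) := by gcongr
      _ = |3 / 2 * t| := by
          rw [abs_mul, abs_of_pos (by norm_num : (0 : ℝ) < 3 / 2)]
          ring

lemma qfiFE_le_of_coupling_pos (hg : 0 < g) (ω t : ℝ) :
    qfiFE g ω t ≤ ENNReal.ofReal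
      ((t * Real.cos (rabi g ω * t) + Real.sin (rabi g ω * t) / g) ^ 2
          / (1 + Real.cos (rabi g ω * t) ^ 2)
        + 5 / 2 * (ω ^ 2 * t ^ 2 / g ^ 2)) := by
  have hΩ := rabi_pos hg.ne' ω
  have hΩg := le_rabi g ω
  have hsq := sq_mul_cos_add_sin_div_rabi_le hg ω t
  have hu := abs_sin_mul_div_le hΩ t
  have hcos := Real.abs_cos_le_one (rabi g ω * t)
  have hbound := qfiFE_le_of_coupling_ne_zero hg.ne' ω t
  set c := Real.cos (rabi g ω * t)
  set h := t * c + Real.sin (rabi g ω * t) / rabi g ω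
  have hh : |h| ≤ 2 * |t| := by
    refine (abs_add_le _ _).trans ?_
    rw [abs_mul]
    nlinarith [abs_nonneg t]
  obtain ⟨y, hmin, hty⟩ := exists_optimal_gauge hh c
  refine (hbound y).trans (ENNReal.ofReal_le_ofReal ?_)
  calc 4 * y ^ 2 + g ^ 2 / rabi g ω ^ 2 * (h - 2 * c * y) ^ 2 + ω ^ 2 / rabi g ω ^ 2 * (t - y) ^ 2
      ≤ 4 * y ^ 2 + 1 * (h - 2 * c * y) ^ 2 + ω ^ 2 / g ^ 2 * (3 / 2 * t) ^ 2 := by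
        gcongr
        exact div_le_one_of_le₀ (by gcongr) (by positivity)
    _ = h ^ 2 / (1 + c ^ 2) + 9 / 4 * (ω ^ 2 * t ^ 2 / g ^ 2) := by
        rw [one_mul, hmin]
        ring
    _ ≤ ((t * c + Real.sin (rabi g ω * t) / g) ^ 2 + ω ^ 2 * t ^ 2 / (4 * g ^ 2)) / (1 + c ^ 2)
          + 9 / 4 * (ω ^ 2 * t ^ 2 / g ^ 2) := by gcongr
    _ ≤ (t * c + Real.sin (rabi g ω * t) / g) ^ 2 / (1 + c ^ 2) + ω ^ 2 * t ^ 2 / (4 * g ^ 2)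
          + 9 / 4 * (ω ^ 2 * t ^ 2 / g ^ 2) := by
        have herror : ω ^ 2 * t ^ 2 / (4 * g ^ 2) / (1 + c ^ 2) ≤ ω ^ 2 * t ^ 2 / (4 * g ^ 2) :=
          div_le_self (by positivity) (by linarith [sq_nonneg c])
        rw [add_div ((t * c + _) ^ 2)]
        linarith
    _ = _ := by ring

lemma qfiFE_le_cos_two_mul_of_coupling_pos (hg : 0 < g) (ω t : ℝ) :
    qfiFE g ω t ≤ ENNReal.ofReal
      (2 * (g * t * Real.cos (rabi g ω * t) + Real.sin (rabi g ω * t)) ^ 2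
          / (g ^ 2 * (Real.cos (2 * t * rabi g ω) + 3))
        + 5 / 2 * (ω ^ 2 * t ^ 2 / g ^ 2)) := by
  convert qfiFE_le_of_coupling_pos hg ω t using 3
  rw [mul_comm (2 * t), mul_left_comm, mul_comm (g ^ 2), mul_div_mul_comm,
    two_div_cos_two_mul_add_three]
  field_simp

lemma sq_sin_rabi_mul_le {ω T t : ℝ} (hg : 0 < g) (hT : 0 < T) (hgT : g ≤ ω ^ 2 * T)
    (ht : |t| ≤ 2 * T) : Real.sin (rabi g ω * t) ^ 2 ≤ 5 * (ω ^ 2 * T ^ 2) := by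
  have hgT_sq : g * T ≤ ω ^ 2 * T ^ 2 := by nlinarith
  rcases le_total 1 (ω ^ 2 * T ^ 2) with hlarge | hsmall
  · linarith [Real.sin_sq_le_one (rabi g ω * t)]
  · calc Real.sin (rabi g ω * t) ^ 2 ≤ (rabi g ω * t) ^ 2 := sq_le_sq.mpr Real.abs_sin_le_abs
      _ = rabi g ω ^ 2 * |t| ^ 2 := by rw [mul_pow, sq_abs]
      _ ≤ (g ^ 2 + ω ^ 2 / 4) * (2 * T) ^ 2 := by
        rw [rabi_sq]
        gcongr
      _ ≤ 5 * (ω ^ 2 * T ^ 2) := by nlinarith [mul_pos hg hT]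

/-- For `T ≥ g / ω²` the terms of order `T / g` are absorbed into the error. -/
lemma qfiFE_le_of_coupling_pos_of_long_time {ω T ξ : ℝ} (hg : 0 < g) (hT : 0 < T)
    (hgT : g ≤ ω ^ 2 * T) (hξ : |ξ| ≤ 1) :
    qfiFE g ω (T * (1 + ξ)) ≤ ENNReal.ofReal
      (2 * T ^ 2 * (1 + ξ) ^ 2 * Real.cos (T * rabi g ω * (1 + ξ)) ^ 2
          / (Real.cos (2 * T * (1 + ξ) * rabi g ω) + 3)
        + 17 * (ω ^ 2 * T ^ 2 / g ^ 2)) := by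
  refine (qfiFE_le_of_coupling_pos hg ω _).trans (ENNReal.ofReal_le_ofReal ?_)
  obtain ⟨hξ_ge, hξ_le⟩ := abs_le.mp hξ
  have ht_nonneg : 0 ≤ T * (1 + ξ) := mul_nonneg hT.le (by linarith)
  have ht_le : T * (1 + ξ) ≤ 2 * T := by nlinarith
  have hsin := sq_sin_rabi_mul_le hg hT hgT ((abs_of_nonneg ht_nonneg).trans_le ht_le)
  rw [sq_mul_cos_div_cos_two_mul_add_three]
  set t := T * (1 + ξ)
  set c := Real.cos (rabi g ω * t)
  set s := Real.sin (rabi g ω * t)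
  have hcs : 2 * (c * s) ≤ 1 := by
    linarith [two_mul_le_add_sq c s, Real.sin_sq_add_cos_sq (rabi g ω * t)]
  have hcross : g * t * (2 * (c * s)) ≤ 2 * (ω ^ 2 * T ^ 2) := by
    calc g * t * (2 * (c * s)) ≤ g * t * 1 := by gcongr
      _ ≤ g * (2 * T) * 1 := by gcongr
      _ ≤ ω ^ 2 * T * (2 * T) * 1 := by gcongr
      _ = _ := by ring
  calc (t * c + s / g) ^ 2 / (1 + c ^ 2) + 5 / 2 * (ω ^ 2 * t ^ 2 / g ^ 2)
      = (t * c) ^ 2 / (1 + c ^ 2) + (g * t * (2 * (c * s)) + s ^ 2) / g ^ 2 / (1 + c ^ 2)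
          + 5 / 2 * (ω ^ 2 * t ^ 2 / g ^ 2) := by
        field_simp
        ring
    _ ≤ (t * c) ^ 2 / (1 + c ^ 2) + (2 * (ω ^ 2 * T ^ 2) + 5 * (ω ^ 2 * T ^ 2)) / g ^ 2 / 1
          + 5 / 2 * (ω ^ 2 * (2 * T) ^ 2 / g ^ 2) := by
        gcongr
        linarith [sq_nonneg c]
    _ = _ := by ring

end StrongCouplingBounds

section PhaseRange

lemma exists_mem_Icc_abs_sin_le {ψ : ℝ} (hψ₀ : 0 ≤ ψ) (hψ : ψ ≤ Real.pi / 2) (m : ℝ) :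
    ∃ x ∈ Set.Icc (m - ψ) (m + ψ), |Real.sin x| ≤ Real.cos ψ := by
  have hpi := Real.pi_pos
  -- the distance from `m` to the nearest zero of `sin`
  set d := m - round (m / Real.pi) * Real.pi with hd_def
  have hd : |d| ≤ Real.pi / 2 := by
    have hround := abs_sub_round (m / Real.pi)
    rw [show d = (m / Real.pi - round (m / Real.pi)) * Real.pi by rw [hd_def]; field_simp,
      abs_mul, abs_of_pos hpi]
    nlinarith
  set r := 2 * ψ / Real.pi with hr
  have hr_nonneg : 0 ≤ r := by positivity
  have hr_le : r ≤ 1 := (div_le_one hpi).mpr (by linarith)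
  have hr_pi : r * (Real.pi / 2) = ψ := by
    rw [hr]
    field_simp
  have hrd : |r * d| ≤ ψ := by
    rw [abs_mul, abs_of_nonneg hr_nonneg, ← hr_pi]
    gcongr
  have hrest : |d - r * d| ≤ Real.pi / 2 - ψ := by
    rw [← one_sub_mul, abs_mul, abs_of_nonneg (sub_nonneg.mpr hr_le)]
    nlinarith
  refine ⟨m - r * d, ⟨by linarith [le_abs_self (r * d)], by linarith [neg_abs_le (r * d)]⟩, ?_⟩
  have hshift : |Real.sin (m - r * d)| = |Real.sin (d - r * d)| := by
    rw [show m - r * d = d - r * d + round (m / Real.pi) * Real.pi by rw [hd_def]; ring,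
      Real.sin_add_int_mul_pi, abs_mul, abs_zpow, abs_neg, abs_one, _root_.one_zpow, one_mul]
  rw [hshift, ← Real.sin_pi_div_two_sub, Real.abs_sin_eq_sin_abs_of_abs_le_pi (by linarith)]
  exact Real.sin_le_sin_of_le_of_le_pi_div_two (by linarith [abs_nonneg (d - r * d)]) (by linarith)
    hrest

lemma sq_mul_cos_add_sin (θ : ℝ) :
    (θ * Real.cos θ + Real.sin θ) ^ 2
      = (1 + θ ^ 2) * Real.sin (θ + Real.arctan θ) ^ 2 := by
  have hpos : 0 < 1 + θ ^ 2 := by positivity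
  rw [Real.sin_add, Real.cos_arctan, Real.sin_arctan,
    show Real.sin θ * (1 / √(1 + θ ^ 2)) + Real.cos θ * (θ / √(1 + θ ^ 2))
      = (θ * Real.cos θ + Real.sin θ) / √(1 + θ ^ 2) by ring, div_pow, Real.sq_sqrt hpos.le,
    mul_div_cancel₀ _ hpos.ne']

/-- By continuity `θ + arctan θ` sweeps an interval at least as long as that of `θ`. -/
lemma exists_mem_Icc_sq_mul_cos_add_sin_le {ψ : ℝ} (hψ₀ : 0 ≤ ψ) (hψ : ψ ≤ Real.pi / 2) (m : ℝ) :
    ∃ θ ∈ Set.Icc (m - ψ) (m + ψ),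
      (θ * Real.cos θ + Real.sin θ) ^ 2 ≤ (1 + θ ^ 2) * Real.cos ψ ^ 2 := by
  obtain ⟨x, hx, hsin⟩ := exists_mem_Icc_abs_sin_le hψ₀ hψ (m + Real.arctan m)
  have hcont : ContinuousOn (fun θ => θ + Real.arctan θ) (Set.Icc (m - ψ) (m + ψ)) := by fun_prop
  have hleft : Real.arctan (m - ψ) ≤ Real.arctan m := Real.arctan_mono (by linarith)
  have hright : Real.arctan m ≤ Real.arctan (m + ψ) := Real.arctan_mono (by linarith)
  obtain ⟨θ, hθ, rfl⟩ : x ∈ (fun θ => θ + Real.arctan θ) '' Set.Icc (m - ψ) (m + ψ) :=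
    intermediate_value_Icc (by linarith) hcont ⟨by linarith [hx.1], by linarith [hx.2]⟩
  refine ⟨θ, hθ, ?_⟩
  rw [sq_mul_cos_add_sin]
  gcongr ?_ * ?_
  exact sq_le_sq.mpr (hsin.trans (le_abs_self _))

lemma one_add_sq_div_sq_le {g T Ω θ : ℝ} (hg : 0 < g) (hT : 0 < T) (hΩg : g ≤ Ω)
    (hθ : |θ - Ω * T| ≤ 2) : (1 + θ ^ 2) / Ω ^ 2 ≤ T ^ 2 * (1 + 3 / (g * T)) ^ 2 := by
  have hΩ := hg.trans_le hΩg
  have hθ_le : |θ| ≤ Ω * T + 2 := by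
    have h := abs_sub_abs_le_abs_sub θ (Ω * T)
    rw [abs_of_pos (by positivity : 0 < Ω * T)] at h
    linarith
  calc (1 + θ ^ 2) / Ω ^ 2 ≤ (Ω * T + 3) ^ 2 / Ω ^ 2 := by
        gcongr
        nlinarith [abs_nonneg θ, sq_abs θ]
    _ = T ^ 2 * (1 + 3 / (Ω * T)) ^ 2 := by field_simp
    _ ≤ _ := by gcongr

lemma exists_qfiFE_le {g T ψ : ℝ} (hg : 0 < g) (hT : 0 < T) (hψ₀ : 0 ≤ ψ)
    (hψ : ψ ≤ Real.pi / 2) (ω : ℝ) :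
    ∃ ξ, |ξ| ≤ ψ / (rabi g ω * T) ∧ qfiFE g ω (T * (1 + ξ)) ≤
      ENNReal.ofReal (T ^ 2 * (1 + 3 / (g * T)) ^ 2 * (ω ^ 2 / g ^ 2 + Real.cos ψ ^ 2)) := by
  have hΩ := rabi_pos hg.ne' ω
  have hΩg := le_rabi g ω
  have hdiv (x : ℝ) := sq_div_rabi_sq_le hg ω x
  have hbound (t : ℝ) := qfiFE_le_of_coupling_ne_zero hg.ne' ω t 0
  set Ω := rabi g ω
  obtain ⟨θ, hθ, hsq⟩ := exists_mem_Icc_sq_mul_cos_add_sin_le hψ₀ hψ (Ω * T)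
  have htime : T * (1 + (θ / (Ω * T) - 1)) = θ / Ω := by
    field_simp
    ring
  have hθ_dist : |θ - Ω * T| ≤ ψ := abs_le.mpr ⟨by linarith [hθ.1], by linarith [hθ.2]⟩
  refine ⟨θ / (Ω * T) - 1, ?_, ?_⟩
  · rw [div_sub_one (by positivity), abs_div, abs_of_pos (by positivity : 0 < Ω * T)]
    gcongr
  have htime_sq := one_add_sq_div_sq_le hg hT hΩg
    (hθ_dist.trans (hψ.trans (by linarith [Real.pi_le_four])))
  rw [htime]
  refine (hbound _).trans (ENNReal.ofReal_le_ofReal ?_)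
  rw [mul_div_cancel₀ _ hΩ.ne']
  calc 4 * 0 ^ 2 + g ^ 2 / Ω ^ 2 * (θ / Ω * Real.cos θ + Real.sin θ / Ω
          - 2 * Real.cos θ * 0) ^ 2 + ω ^ 2 / Ω ^ 2 * (θ / Ω - 0) ^ 2
      = g ^ 2 / Ω ^ 2 * ((θ * Real.cos θ + Real.sin θ) ^ 2 / Ω ^ 2)
          + ω ^ 2 / Ω ^ 2 * (θ ^ 2 / Ω ^ 2) := by ring
    _ ≤ g ^ 2 / g ^ 2 * ((1 + θ ^ 2) * Real.cos ψ ^ 2 / Ω ^ 2)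
          + ω ^ 2 / g ^ 2 * ((1 + θ ^ 2) / Ω ^ 2) := by
      gcongr ?_ * (?_ / _) + ?_ * (?_ / _)
      · exact hdiv g
      · exact hdiv ω
      · linarith
    _ = (1 + θ ^ 2) / Ω ^ 2 * (ω ^ 2 / g ^ 2 + Real.cos ψ ^ 2) := by
      rw [div_self (by positivity)]
      ring
    _ ≤ _ := by gcongr

end PhaseRange

section ProductDistribution

variable {ι α R : Type*} [Fintype ι] [DecidableEq ι] [Fintype α] [CommSemiring R] {p l : α → R}

lemma sum_prod_mul_prod (p : α → R) (h : ι → α → R) :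
    ∑ x : ι → α, (∏ i, p (x i)) * ∏ i, h i (x i) = ∏ i, ∑ y, p y * h i y := by
  simp only [Fintype.prod_sum, Finset.prod_mul_distrib]

lemma sum_prod_eq_one (hp : ∑ y, p y = 1) : ∑ x : ι → α, ∏ i, p (x i) = 1 := by
  rw [← Fintype.prod_sum, hp, Finset.prod_const_one]

lemma sum_prod_mul_apply (hp : ∑ y, p y = 1) (i : ι) (h : α → R) :
    ∑ x : ι → α, (∏ j, p (x j)) * h (x i) = ∑ y, p y * h y := by
  have hprod := sum_prod_mul_prod p fun j y => if j = i then h y else 1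
  simp only [Finset.prod_ite_eq', Finset.mem_univ, if_true] at hprod
  rw [hprod, Finset.prod_eq_single_of_mem i (Finset.mem_univ i)]
  · simp only [if_true]
  · intro j _ hj
    simpa only [hj, if_false, mul_one] using hp

lemma sum_prod_mul_apply_mul_apply (hl : ∑ y, p y * l y = 0) {i j : ι} (hij : i ≠ j) :
    ∑ x : ι → α, (∏ r, p (x r)) * (l (x i) * l (x j)) = 0 := by
  have hprod := sum_prod_mul_prod p
    fun r y => (if r = i then l y else 1) * (if r = j then l y else 1)
  simp only [Finset.prod_mul_distrib, Finset.prod_ite_eq', Finset.mem_univ, if_true] at hprod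
  rw [hprod]
  refine Finset.prod_eq_zero (Finset.mem_univ i) ?_
  simpa only [if_true, hij, if_false, mul_one] using hl

lemma sum_prod_mul_sum (hp : ∑ y, p y = 1) (hl : ∑ y, p y * l y = 0) :
    ∑ x : ι → α, (∏ i, p (x i)) * ∑ i, l (x i) = 0 := by
  simp only [Finset.mul_sum]
  rw [Finset.sum_comm]
  exact Finset.sum_eq_zero fun i _ => (sum_prod_mul_apply hp i l).trans hl

lemma sum_prod_mul_sum_sq (hp : ∑ y, p y = 1) (hl : ∑ y, p y * l y = 0) :
    ∑ x : ι → α, (∏ i, p (x i)) * (∑ i, l (x i)) ^ 2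
      = Fintype.card ι * ∑ y, p y * l y ^ 2 := by
  have hdiag (i : ι) : ∑ j, ∑ x : ι → α, (∏ r, p (x r)) * (l (x i) * l (x j))
      = ∑ y, p y * l y ^ 2 := by
    rw [Finset.sum_eq_single_of_mem i (Finset.mem_univ i)
      fun j _ hj => sum_prod_mul_apply_mul_apply hl hj.symm]
    simp only [← sq]
    exact sum_prod_mul_apply hp i fun y => l y ^ 2
  calc ∑ x : ι → α, (∏ i, p (x i)) * (∑ i, l (x i)) ^ 2
      = ∑ x : ι → α, ∑ i, ∑ j, (∏ r, p (x r)) * (l (x i) * l (x j)) := by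
        simp only [sq (Finset.sum _ _), Finset.sum_mul_sum]
        simp only [Finset.mul_sum]
    _ = ∑ i, ∑ j, ∑ x : ι → α, (∏ r, p (x r)) * (l (x i) * l (x j)) := by
        rw [Finset.sum_comm]
        exact Finset.sum_congr rfl fun i _ => Finset.sum_comm
    _ = Fintype.card ι * ∑ y, p y * l y ^ 2 := by
        rw [Finset.sum_congr rfl fun i _ => hdiag i, Finset.sum_const, nsmul_eq_mul,
          Finset.card_univ]

lemma hasDerivAt_sum_prod_mul {𝕜 : Type*} [NontriviallyNormedField 𝕜] {p : 𝕜 → α → 𝕜}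
    {l : α → 𝕜} {w : 𝕜} (hp : ∀ y, HasDerivAt (fun v => p v y) (p w y * l y) w)
    (F : (ι → α) → 𝕜) :
    HasDerivAt (fun v => ∑ x, (∏ i, p v (x i)) * F x)
      (∑ x, (∏ i, p w (x i)) * (∑ i, l (x i)) * F x) w := by
  refine HasDerivAt.fun_sum fun x _ => HasDerivAt.mul_const ?_ _
  refine (HasDerivAt.fun_finsetProd fun i _ => hp (x i)).congr_deriv ?_
  simp only [smul_eq_mul, ← mul_assoc, Finset.mul_sum,
    Finset.prod_erase_mul _ _ (Finset.mem_univ _)]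

end ProductDistribution

section CramerRao

/-- This is the Cauchy–Schwarz inequality for `F - ω` and `S - 1 / ω`. The shift `-1 / ω` makes the
right-hand side finite when the score `S` vanishes. -/
lemma sq_le_sum_sq_sub_mul_of_score {Ω : Type*} [Fintype Ω] {W S : Ω → ℝ} {ω : ℝ}
    (hW : ∀ x, 0 ≤ W x) (hW_sum : ∑ x, W x = 1) (hS : ∑ x, W x * S x = 0) (hω : ω ≠ 0)
    (F : Ω → ℝ) :
    (∑ x, W x * S x * F x - (∑ x, W x * F x - ω) / ω) ^ 2
      ≤ (∑ x, W x * (F x - ω) ^ 2) * (1 / ω ^ 2 + ∑ x, W x * S x ^ 2) := by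
  have hcs := Finset.sum_sq_le_sum_mul_sum_of_sq_le_mul Finset.univ
    (r := fun x => W x * ((F x - ω) * (S x - 1 / ω)))
    (fun x _ => mul_nonneg (hW x) (sq_nonneg (F x - ω)))
    (fun x _ => mul_nonneg (hW x) (sq_nonneg (S x - 1 / ω))) (fun x _ => le_of_eq (by ring))
  have hleft : ∑ x, W x * ((F x - ω) * (S x - 1 / ω))
      = ∑ x, W x * S x * F x - (∑ x, W x * F x - ω) / ω := by
    have hterm (x : Ω) : W x * ((F x - ω) * (S x - 1 / ω))
        = W x * S x * F x - 1 / ω * (W x * F x) - ω * (W x * S x) + W x := by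
      field_simp
      ring
    simp only [hterm, Finset.sum_add_distrib, Finset.sum_sub_distrib, ← Finset.mul_sum, hS, hW_sum]
    field_simp
    ring
  have hright : ∑ x, W x * (S x - 1 / ω) ^ 2 = 1 / ω ^ 2 + ∑ x, W x * S x ^ 2 := by
    have hterm (x : Ω) : W x * (S x - 1 / ω) ^ 2
        = W x * S x ^ 2 - 2 / ω * (W x * S x) + 1 / ω ^ 2 * W x := by ring
    simp only [hterm, Finset.sum_add_distrib, Finset.sum_sub_distrib, ← Finset.mul_sum, hS, hW_sum]
    ring
  rwa [hleft, hright] at hcs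

lemma one_sub_sq_le_sq_of_abs_sub_le {b m κ ω : ℝ} (hω : ω ≠ 0) (hκ : κ ≤ 1)
    (hbias : |b - m * ω| ≤ κ * |ω|) : (1 - κ) ^ 2 ≤ (m + 1 - b / ω) ^ 2 := by
  have hrel : |b / ω - m| ≤ κ := by
    rwa [← mul_le_mul_iff_left₀ (abs_pos.mpr hω), ← abs_mul, sub_mul, div_mul_cancel₀ _ hω]
  have hlower : 1 - κ ≤ m + 1 - b / ω := by linarith [(abs_le.mp hrel).2]
  exact pow_le_pow_left₀ (sub_nonneg.mpr hκ) hlower 2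

end CramerRao

namespace FEStrategy

variable {ν : ℕ} (s : FEStrategy ν) {g ω t T ξ κ : ℝ} {f : ProbabilityMeasure ℝ}
  {L : Matrix (Fin 2 × Fin s.ancillaDim) (Fin 2 × Fin s.ancillaDim) ℂ}

lemma prob_nonneg (g ω t : ℝ) (x : Fin s.numOutcomes) : 0 ≤ s.prob g ω t x :=
  re_trace_mul_nonneg (posSemidef_finalState s.probe g ω t) (s.povm_posSemidef x)

lemma sum_prob (g ω t : ℝ) : ∑ x, s.prob g ω t x = 1 := by
  simp only [prob]
  rw [← Complex.re_sum, ← Matrix.trace_sum, ← Matrix.mul_sum, s.povm_sum, Matrix.mul_one,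
    trace_finalState, Complex.one_re]

lemma hasDerivAt_prob_of_isSLD (hL : IsSLD (fun w => finalState g w t s.probe) ω L)
    (x : Fin s.numOutcomes) :
    HasDerivAt (fun w => s.prob g w t x) (finalState g ω t s.probe * L * s.povm x).trace.re ω := by
  obtain ⟨R, hR⟩ := exists_hasEntrywiseDerivAt_finalState s.probe g ω t
  have hderiv := (hR.mul (.const (s.povm x))).trace_re
  rwa [Matrix.mul_zero, add_zero, ((isSLD_iff hR).mp hL).2,
    re_trace_anticommutator_mul (posSemidef_finalState s.probe g ω t).isHermitian hL.1
      (s.povm_posSemidef x).isHermitian] at hderiv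

lemma exists_score_of_isSLD (hL : IsSLD (fun w => finalState g w t s.probe) ω L) :
    ∃ l : Fin s.numOutcomes → ℝ,
      (∀ x, HasDerivAt (fun w => s.prob g w t x) (s.prob g ω t x * l x) ω) ∧
      ∑ x, s.prob g ω t x * l x ^ 2 ≤ (finalState g ω t s.probe * L * L).trace.re := by
  set ρ := finalState g ω t s.probe
  have hρ_pos : ρ.PosSemidef := posSemidef_finalState s.probe g ω t
  have hsq (x) : (ρ * L * s.povm x).trace.re ^ 2
      ≤ s.prob g ω t x * (L * ρ * L * s.povm x).trace.re :=
    sq_re_trace_mul_mul_le hρ_pos (s.povm_posSemidef x) hL.1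
  have hmul (x) : s.prob g ω t x * ((ρ * L * s.povm x).trace.re / s.prob g ω t x)
      = (ρ * L * s.povm x).trace.re := by
    refine mul_div_cancel_of_imp' fun hzero => ?_
    simpa only [hzero, zero_mul, sq_nonpos_iff] using hsq x
  refine ⟨fun x => (ρ * L * s.povm x).trace.re / s.prob g ω t x, fun x => ?_, ?_⟩
  · rw [hmul]
    exact s.hasDerivAt_prob_of_isSLD hL x
  have hsum : (ρ * L * L).trace.re = ∑ x, (L * ρ * L * s.povm x).trace.re := by
    rw [← Complex.re_sum, ← Matrix.trace_sum, ← Matrix.mul_sum, s.povm_sum, Matrix.mul_one,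
      Matrix.mul_assoc L, Matrix.trace_mul_comm L]
  rw [hsum]
  refine Finset.sum_le_sum fun x _ => ?_
  rw [sq, ← mul_assoc, hmul, mul_div_assoc', ← sq]
  have hLρL := hρ_pos.mul_mul_conjTranspose_same L
  rw [hL.1.eq] at hLρL
  exact div_le_of_le_mul₀ (s.prob_nonneg g ω t x)
    (re_trace_mul_nonneg hLρL (s.povm_posSemidef x)) ((hsq x).trans_eq (mul_comm _ _))

lemma expect_eq_of_dirac (hf : (f : Measure ℝ) = Measure.dirac ξ) (g ω T : ℝ)
    (F : (Fin ν → Fin s.numOutcomes) → ℝ) :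
    s.expect g ω T f F = ∑ x, (∏ i, s.prob g ω (T * (1 + ξ)) (x i)) * F x := by
  simp only [expect, effProb, hf, integral_dirac]

lemma mse_nonneg_of_dirac (hf : (f : Measure ℝ) = Measure.dirac ξ) (g ω T : ℝ) :
    0 ≤ s.mse g ω T f := by
  rw [mse, s.expect_eq_of_dirac hf]
  exact Finset.sum_nonneg fun x _ =>
    mul_nonneg (Finset.prod_nonneg fun i _ => s.prob_nonneg g ω _ (x i)) (sq_nonneg _)

lemma sq_le_mse_mul_of_isSLD (hω : ω ≠ 0) (hκ : κ ≤ 1)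
    (hf : (f : Measure ℝ) = Measure.dirac ξ) (hbias : s.BiasLinear κ g ω T f)
    (hL : IsSLD (fun w => finalState g w (T * (1 + ξ)) s.probe) ω L) :
    (1 - κ) ^ 2 ≤ s.mse g ω T f * (1 / ω ^ 2
      + ν * (finalState g ω (T * (1 + ξ)) s.probe * L * L).trace.re) := by
  obtain ⟨l, hl, hinfo⟩ := s.exists_score_of_isSLD hL
  set p := fun w => s.prob g w (T * (1 + ξ)) with hp
  have hp_sum : ∑ x, p ω x = 1 := s.sum_prob g ω _
  have hscore : ∑ x, p ω x * l x = 0 := by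
    have hconst : HasDerivAt (fun w => ∑ x, p w x) (∑ x, p ω x * l x) ω :=
      HasDerivAt.fun_sum fun x _ => hl x
    simp only [hp, sum_prob] at hconst
    exact hconst.unique (hasDerivAt_const ω 1)
  have hbias_deriv : HasDerivAt (fun w => s.bias g w T f)
      (∑ x, (∏ i, p ω (x i)) * (∑ i, l (x i)) * s.estimator x - 1) ω := by
    simp only [bias, s.expect_eq_of_dirac hf]
    exact (hasDerivAt_sum_prod_mul (p := p) hl s.estimator).sub (hasDerivAt_id ω)
  rw [BiasLinear, hbias_deriv.deriv] at hbias
  have hcr := sq_le_sum_sq_sub_mul_of_score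
    (fun x => Finset.prod_nonneg fun i _ => s.prob_nonneg g ω (T * (1 + ξ)) (x i))
    (sum_prod_eq_one hp_sum) (sum_prod_mul_sum hp_sum hscore) hω s.estimator
  rw [sum_prod_mul_sum_sq hp_sum hscore, Fintype.card_fin] at hcr
  have hlower := one_sub_sq_le_sq_of_abs_sub_le hω hκ hbias
  rw [sub_add_cancel, bias, s.expect_eq_of_dirac hf] at hlower
  calc (1 - κ) ^ 2 ≤ s.mse g ω T f * (1 / ω ^ 2 + ν * ∑ x, p ω x * l x ^ 2) := by
        rw [mse, s.expect_eq_of_dirac hf]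
        exact hlower.trans hcr
    _ ≤ s.mse g ω T f * (1 / ω ^ 2
          + ν * (finalState g ω (T * (1 + ξ)) s.probe * L * L).trace.re) := by
        have := s.mse_nonneg_of_dirac hf g ω T
        gcongr

end FEStrategy

section Loss

variable {g ω T ε κ ξ : ℝ} {ν : ℕ} {𝒩 : Set (ProbabilityMeasure ℝ)}

lemma deltaTDI_subset (h𝒩 : 𝒩 = deltaTDI ε ∨ 𝒩 = boundedTDI ε) : deltaTDI ε ⊆ 𝒩 := by
  rcases h𝒩 with rfl | rfl
  · exact subset_rfl
  rintro f ⟨ξ, hξ, hf⟩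
  rw [boundedTDI, Set.mem_ofPred_eq, hf, Measure.dirac_apply' _ measurableSet_Icc.compl,
    Set.indicator_of_notMem (Set.notMem_compl_iff.mpr hξ)]

lemma div_le_lossFE (hω : ω ≠ 0) (hκ : κ ≤ 1) (h𝒩 : deltaTDI ε ⊆ 𝒩) (hξ : ξ ∈ Set.Icc (-ε) ε) :
    ENNReal.ofReal ((1 - κ) ^ 2) /
        (ENNReal.ofReal (1 / ω ^ 2) + (ν : ℝ≥0∞) * qfiFE g ω (T * (1 + ξ)))
      ≤ lossFE κ 𝒩 ν g ω T := by
  refine le_iInf₂ fun s hs => ?_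
  let f : ProbabilityMeasure ℝ := ⟨Measure.dirac ξ, inferInstance⟩
  have hf : f ∈ 𝒩 := h𝒩 ⟨ξ, hξ, rfl⟩
  obtain ⟨R, hR⟩ := exists_hasEntrywiseDerivAt_finalState s.probe g ω (T * (1 + ξ))
  have hpos w := posSemidef_finalState s.probe g w (T * (1 + ξ))
  obtain ⟨L, hL⟩ := exists_isSLD hpos hR
  set F := (finalState g ω (T * (1 + ξ)) s.probe * L * L).trace.re
  have hqfi : ENNReal.ofReal F ≤ qfiFE g ω (T * (1 + ξ)) := by
    rw [← hL.qfi_eq (hpos ω).isHermitian]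
    exact le_iSup₂_of_le s.ancillaDim s.probe le_rfl
  refine le_trans (ENNReal.div_le_of_le_mul ?_)
    (le_iSup₂ (f := fun f (_ : f ∈ 𝒩) => ENNReal.ofReal (s.mse g ω T f)) f hf)
  calc ENNReal.ofReal ((1 - κ) ^ 2)
      ≤ ENNReal.ofReal (s.mse g ω T f * (1 / ω ^ 2 + ν * F)) :=
        ENNReal.ofReal_le_ofReal (s.sq_le_mse_mul_of_isSLD hω hκ rfl (hs f hf) hL)
    _ = ENNReal.ofReal (s.mse g ω T f) * ENNReal.ofReal (1 / ω ^ 2 + ν * F) :=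
        ENNReal.ofReal_mul (s.mse_nonneg_of_dirac rfl g ω T)
    _ ≤ ENNReal.ofReal (s.mse g ω T f)
          * (ENNReal.ofReal (1 / ω ^ 2) + (ν : ℝ≥0∞) * ENNReal.ofReal F) := by
        rw [← ENNReal.ofReal_natCast ν, ← ENNReal.ofReal_mul (Nat.cast_nonneg ν)]
        gcongr
        exact ENNReal.ofReal_add_le
    _ ≤ ENNReal.ofReal (s.mse g ω T f)
          * (ENNReal.ofReal (1 / ω ^ 2) + (ν : ℝ≥0∞) * qfiFE g ω (T * (1 + ξ))) := by
        gcongr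

lemma ofReal_div_le_lossFE {X : ℝ} (hω : ω ≠ 0) (hκ : κ ≤ 1) (h𝒩 : deltaTDI ε ⊆ 𝒩)
    (hξ : ξ ∈ Set.Icc (-ε) ε) (hX : 0 ≤ X)
    (hq : qfiFE g ω (T * (1 + ξ)) ≤ ENNReal.ofReal X) :
    ENNReal.ofReal ((1 - κ) ^ 2 / (1 / ω ^ 2 + ν * X)) ≤ lossFE κ 𝒩 ν g ω T := by
  refine le_trans ?_ (div_le_lossFE hω hκ h𝒩 hξ)
  rw [ENNReal.ofReal_div_of_pos (by positivity), ENNReal.ofReal_add (by positivity) (by positivity),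
    ENNReal.ofReal_mul (Nat.cast_nonneg ν), ENNReal.ofReal_natCast]
  gcongr

end Loss

section ZeroCoupling

/-- The probe state `|+⟩⟨+|` with a trivial ancilla; it attains the quantum Fisher information `T²`
of the free qubit. -/
noncomputable def plusProbe : DensityMatrix (Fin 2 × Fin 1) where
  mat := Matrix.of fun _ _ => 1 / 2
  posSemidef := by
    convert (Matrix.posSemidef_vecMulVec_self_star (1 : Fin 2 × Fin 1 → ℂ)).smul
      (show (0 : ℂ) ≤ 1 / 2 by positivity) using 1
    ext i j
    simp [Matrix.vecMulVec]
  trace_eq_one := by simp [Matrix.trace]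

/-- The symmetric logarithmic derivative of the probe `|+⟩⟨+|` that has evolved without environment
for the duration `T`. -/
noncomputable def plusSLD (ω T : ℝ) : Matrix (Fin 2 × Fin 1) (Fin 2 × Fin 1) ℂ :=
  Matrix.of fun p q => T * !![0, -Complex.I * Complex.exp (-(Complex.I * T * ω));
    Complex.I * Complex.exp (Complex.I * T * ω), 0] p.1 q.1

lemma exp_mul_conj_exp (t x y : ℝ) :
    Complex.exp (-(Complex.I * t) * x) * (starRingEnd ℂ) (Complex.exp (-(Complex.I * t) * y))
      = Complex.exp (Complex.I * t * (y - x)) := by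
  rw [← Complex.exp_conj, ← Complex.exp_add]
  simp only [map_mul, map_neg, Complex.conj_I, Complex.conj_ofReal]
  ring_nf

lemma finalState_zero_coupling_plusProbe (ω T : ℝ) :
    finalState 0 ω T plusProbe = Matrix.of fun p q =>
      1 / 2 * !![1, Complex.exp (-(Complex.I * T * ω)); Complex.exp (Complex.I * T * ω), 1]
        p.1 q.1 := by
  have hphase (x y : ℝ) :
      Complex.exp (-(Complex.I * T) * x) * (1 / 2)
          * (starRingEnd ℂ) (Complex.exp (-(Complex.I * T) * y))
        = 1 / 2 * Complex.exp (Complex.I * T * (y - x)) := by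
    rw [← exp_mul_conj_exp]
    ring
  have hlower : Complex.exp (Complex.I * T * ((1 - ω / 2 : ℝ) - (1 + ω / 2 : ℝ)))
      = Complex.exp (-(Complex.I * T * ω)) := by
    push_cast
    ring_nf
  have hupper : Complex.exp (Complex.I * T * ((1 + ω / 2 : ℝ) - (1 - ω / 2 : ℝ)))
      = Complex.exp (Complex.I * T * ω) := by
    push_cast
    ring_nf
  rw [finalState_eq_sum_kraus, kraus_zero_coupling]
  ext ⟨i, j⟩ ⟨i', j'⟩
  fin_cases j; fin_cases j'
  fin_cases i <;> fin_cases i' <;>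
    simp [dampingKraus, plusProbe, Matrix.mul_apply, Fintype.sum_prod_type, -one_div, -neg_mul,
      -Complex.ofReal_add, -Complex.ofReal_sub, hphase, hlower, hupper]

lemma plusSLD_mul_self (ω T : ℝ) : plusSLD ω T * plusSLD ω T = ((T ^ 2 : ℝ) : ℂ) • 1 := by
  have hexp : Complex.exp (-(Complex.I * T * ω)) * Complex.exp (Complex.I * T * ω) = 1 := by
    rw [← Complex.exp_add, neg_add_cancel, Complex.exp_zero]
  ext ⟨i, j⟩ ⟨i', j'⟩
  fin_cases j; fin_cases j'
  fin_cases i <;> fin_cases i' <;>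
    simp [plusSLD, Matrix.mul_apply, Fintype.sum_prod_type]
  all_goals linear_combination (T : ℂ) ^ 2 * hexp - (T : ℂ) ^ 2 * Complex.exp (Complex.I * T * ω)
    * Complex.exp (-(Complex.I * T * ω)) * Complex.I_sq

lemma isSLD_plusSLD (ω T : ℝ) :
    IsSLD (fun w => finalState 0 w T plusProbe) ω (plusSLD ω T) := by
  have hderiv : HasEntrywiseDerivAt (fun w => finalState 0 w T plusProbe)
      ((1 / 2 : ℂ) • plusSLD ω T) ω := by
    simp only [finalState_zero_coupling_plusProbe]
    have hlin : HasDerivAt (fun w : ℝ => Complex.I * T * (w : ℂ)) (Complex.I * T) ω := by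
      simpa using (Complex.ofRealCLM.hasDerivAt (x := ω)).const_mul (Complex.I * (T : ℂ))
    intro ⟨i, j⟩ ⟨i', j'⟩
    fin_cases i <;> fin_cases i'
    · simpa [plusSLD] using hasDerivAt_const ω (2⁻¹ : ℂ)
    · simpa [plusSLD, mul_comm, mul_left_comm, mul_assoc] using
        hlin.fun_neg.cexp.const_mul (2⁻¹ : ℂ)
    · simpa [plusSLD, mul_comm, mul_left_comm, mul_assoc] using
        hlin.cexp.const_mul (2⁻¹ : ℂ)
    · simpa [plusSLD] using hasDerivAt_const ω (2⁻¹ : ℂ)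
  rw [isSLD_iff hderiv]
  constructor
  · ext ⟨i, j⟩ ⟨i', j'⟩
    fin_cases i <;> fin_cases i' <;> simp [plusSLD, ← Complex.exp_conj]
  rw [finalState_zero_coupling_plusProbe]
  congr 1
  ext ⟨i, j⟩ ⟨i', j'⟩
  fin_cases i <;> fin_cases i' <;>
    simp [plusSLD, Matrix.mul_apply, Fintype.sum_prod_type]
  all_goals ring

lemma qfiFE_zero_coupling_le (ω T : ℝ) : qfiFE 0 ω T ≤ ENNReal.ofReal (T ^ 2) := by
  have hφ := ((((hasDerivAt_id' ω).div_const 2).const_add 1).ofReal_comp.const_mul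
    (-(Complex.I * T))).cexp
  have ha := ((((hasDerivAt_id' ω).div_const 2).const_sub 1).ofReal_comp.const_mul
    (-(Complex.I * T))).cexp
  rw [show T ^ 2 = 4 * (T / 2) ^ 2 by ring]
  refine qfiFE_le_of_dampingKraus (x := 0) (fun w => kraus_zero_coupling w T) hφ ha
    (hasDerivAt_const ω 0) (le_of_eq ?_) (le_of_eq ?_)
  · simp [Complex.norm_exp, div_eq_mul_inv, mul_pow]
  · simp [Complex.norm_exp, div_eq_mul_inv, mul_pow]

lemma qfiFE_zero_coupling (ω T : ℝ) : qfiFE 0 ω T = ENNReal.ofReal (T ^ 2) := by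
  refine le_antisymm (qfiFE_zero_coupling_le ω T) (le_iSup₂_of_le 1 plusProbe ?_)
  rw [(isSLD_plusSLD ω T).qfi_eq (posSemidef_finalState plusProbe 0 ω T).isHermitian,
    Matrix.mul_assoc, plusSLD_mul_self, Matrix.mul_smul, Matrix.mul_one, Matrix.trace_smul,
    trace_finalState, smul_eq_mul, mul_one, Complex.ofReal_re]

end ZeroCoupling

section LossBounds

lemma one_sub_two_mul_mul_le_inv_add_sq_mul {a b η : ℝ} (ha : 0 < a) (hb : 0 ≤ b) (hη : 0 ≤ η) :
    (1 - 2 * η) * (1 / (a + b)) ≤ 1 / (a + (1 + η) ^ 2 * b) := by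
  have hscale : a + (1 + η) ^ 2 * b ≤ (1 + η) ^ 2 * (a + b) := by
    nlinarith [mul_nonneg hη ha.le, mul_nonneg (sq_nonneg η) ha.le]
  have hsq : (1 - 2 * η) * (1 + η) ^ 2 ≤ 1 := by
    nlinarith [sq_nonneg η, mul_nonneg hη (sq_nonneg η)]
  calc (1 - 2 * η) * (1 / (a + b)) ≤ 1 / (1 + η) ^ 2 * (1 / (a + b)) := by
        gcongr
        rwa [le_div_iff₀ (by positivity)]
    _ = 1 / ((1 + η) ^ 2 * (a + b)) := by rw [one_div_mul_one_div]
    _ ≤ 1 / (a + (1 + η) ^ 2 * b) := one_div_le_one_div_of_le (by positivity) hscale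

variable {g ω T ε κ : ℝ} {ν : ℕ} {𝒩 : Set (ProbabilityMeasure ℝ)}

lemma ofReal_mul_le_lossFE_of_phase_le {ψ : ℝ} (hg : 0 < g) (hω : ω ≠ 0) (hT : 0 < T) (hκ : κ ≤ 1)
    (h𝒩 : deltaTDI ε ⊆ 𝒩) (hψ₀ : 0 ≤ ψ) (hψ : ψ ≤ Real.pi / 2) (hε : ψ / (rabi g ω * T) ≤ ε) :
    ENNReal.ofReal ((1 - κ) ^ 2 * ((1 - 6 / (g * T)) *
      (1 / (1 / ω ^ 2 + ν * T ^ 2 * (ω ^ 2 / g ^ 2 + Real.cos ψ ^ 2))))) ≤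
      lossFE κ 𝒩 ν g ω T := by
  obtain ⟨ξ, hξ, hqfi⟩ := exists_qfiFE_le hg hT hψ₀ hψ ω
  refine le_trans (ENNReal.ofReal_le_ofReal ?_)
    (ofReal_div_le_lossFE hω hκ h𝒩 (abs_le.mp (hξ.trans hε)) (by positivity) hqfi)
  have hbound := one_sub_two_mul_mul_le_inv_add_sq_mul (a := 1 / ω ^ 2)
    (b := ν * T ^ 2 * (ω ^ 2 / g ^ 2 + Real.cos ψ ^ 2)) (η := 3 / (g * T))
    (by positivity) (by positivity) (by positivity)
  rw [← mul_one_div ((1 - κ) ^ 2)]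
  refine mul_le_mul_of_nonneg_left ?_ (sq_nonneg _)
  have hη : 2 * (3 / (g * T)) = 6 / (g * T) := by ring
  have hinflated (r x : ℝ) : r ^ 2 * (ν * T ^ 2 * x) = ν * (T ^ 2 * r ^ 2 * x) := by ring
  rw [hη, hinflated] at hbound
  exact hbound

lemma boundLarge_eq (hg : g ≠ 0) (hω : ω ≠ 0) (ν : ℕ) (T : ℝ) :
    boundLarge ν g ω T = 1 / (1 / ω ^ 2 + ν * T ^ 2 * (ω ^ 2 / g ^ 2)) := by
  have hden : 0 < (ν : ℝ) * ω ^ 4 * T ^ 2 + g ^ 2 := by positivity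
  have hden' : 0 < 1 / ω ^ 2 + (ν : ℝ) * T ^ 2 * (ω ^ 2 / g ^ 2) := by positivity
  rw [boundLarge, div_eq_div_iff hden.ne' hden'.ne']
  field_simp
  ring

lemma boundLarge_le_lossFE (hg : 0 < g) (hω : ω ≠ 0) (hT : 0 < T) (hκ : κ ≤ 1)
    (h𝒩 : deltaTDI ε ⊆ 𝒩) (hε : epsStar g ω T ≤ ε) :
    ENNReal.ofReal ((1 - κ) ^ 2 * ((1 - 6 / (g * T)) * boundLarge ν g ω T)) ≤
      lossFE κ 𝒩 ν g ω T := by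
  have hphase : Real.pi / 2 / (rabi g ω * T) ≤ ε := by
    rwa [div_div, ← mul_assoc]
  have hloss := ofReal_mul_le_lossFE_of_phase_le (ν := ν) hg hω hT hκ h𝒩
    Real.pi_div_two_pos.le le_rfl hphase
  rwa [Real.cos_pi_div_two, zero_pow two_ne_zero, add_zero, ← boundLarge_eq hg.ne' hω] at hloss

lemma boundSmall_le_lossFE (hg : 0 < g) (hω : ω ≠ 0) (hT : 0 < T) (hκ : κ ≤ 1)
    (h𝒩 : deltaTDI ε ⊆ 𝒩) (hε₀ : 0 ≤ ε) (hε : ε ≤ epsStar g ω T) :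
    ENNReal.ofReal ((1 - κ) ^ 2 * ((1 - 6 / (g * T)) * boundSmall ν g ω T ε)) ≤
      lossFE κ 𝒩 ν g ω T := by
  have hΩ : 0 < rabi g ω := rabi_pos hg.ne' ω
  have hphase : ε * T * rabi g ω ≤ Real.pi / 2 := by
    rw [epsStar, le_div_iff₀ (by positivity)] at hε
    linarith
  rw [boundSmall, add_comm (_ * _)]
  refine ofReal_mul_le_lossFE_of_phase_le hg hω hT hκ h𝒩 (by positivity) hphase (le_of_eq ?_)
  field_simp

end LossBounds

lemma tendsto_boundLarge_div_heisenbergLimit (g : ℝ) {ω : ℝ} (hω : ω ≠ 0) :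
    Tendsto (fun p : ℕ × ℝ => boundLarge p.1 g ω p.2 / heisenbergLimit p.1 p.2)
      (atTop ×ˢ atTop) (𝓝 (g ^ 2 / ω ^ 2)) := by
  have hy : Tendsto (fun p : ℕ × ℝ => (p.1 : ℝ) * p.2 ^ 2) (atTop ×ˢ atTop) atTop :=
    (tendsto_natCast_atTop_atTop.comp tendsto_fst).atTop_mul_atTop₀
      ((tendsto_pow_atTop two_ne_zero).comp tendsto_snd)
  have hlim : Tendsto (fun y : ℝ => g ^ 2 * ω ^ 2 / (ω ^ 4 + g ^ 2 * y⁻¹)) atTop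
      (𝓝 (g ^ 2 * ω ^ 2 / (ω ^ 4 + g ^ 2 * 0))) :=
    tendsto_const_nhds.div (tendsto_const_nhds.add (tendsto_inv_atTop_zero.const_mul _))
      (by simpa using hω)
  rw [show g ^ 2 * ω ^ 2 / (ω ^ 4 + g ^ 2 * 0) = g ^ 2 / ω ^ 2 by field_simp; ring] at hlim
  refine (hlim.comp hy).congr' ?_
  filter_upwards [hy.eventually_gt_atTop 0] with p hp
  simp only [Function.comp_apply, boundLarge, heisenbergLimit, mul_right_comm _ (ω ^ 4)]
  generalize (p.1 : ℝ) * p.2 ^ 2 = y at hp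
  field_simp

end TDI

theorem mainTheorem2_general :
    (∀ ω T : ℝ, TDI.qfiFE 0 ω T = ENNReal.ofReal (T ^ 2)) ∧
    (∀ (g ω T ε κ : ℝ) (ν : ℕ) (𝒩 : Set (ProbabilityMeasure ℝ)),
      ω ≠ 0 → κ ≤ 1 → TDI.deltaTDI ε ⊆ 𝒩 →
      (⨆ ξ ∈ Set.Icc (-ε) ε,
          ENNReal.ofReal ((1 - κ) ^ 2) /
            (ENNReal.ofReal (1 / ω ^ 2) + (ν : ℝ≥0∞) * TDI.qfiFE g ω (T * (1 + ξ))))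
        ≤ TDI.lossFE κ 𝒩 ν g ω T) ∧
    (∃ C : ℝ, 0 < C ∧
      (∀ g ω t : ℝ, 0 < g →
        TDI.qfiFE g ω t ≤ ENNReal.ofReal
          (2 * (g * t * Real.cos (TDI.rabi g ω * t) + Real.sin (TDI.rabi g ω * t)) ^ 2
              / (g ^ 2 * (Real.cos (2 * t * TDI.rabi g ω) + 3))
            + C * (ω ^ 2 * t ^ 2 / g ^ 2))) ∧
      (∀ g ω T ξ : ℝ, 0 < g → 0 < T → g ≤ ω ^ 2 * T → |ξ| ≤ 1 →
        TDI.qfiFE g ω (T * (1 + ξ)) ≤ ENNReal.ofReal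
          (2 * T ^ 2 * (1 + ξ) ^ 2 * Real.cos (T * TDI.rabi g ω * (1 + ξ)) ^ 2
              / (Real.cos (2 * T * (1 + ξ) * TDI.rabi g ω) + 3)
            + C * (ω ^ 2 * T ^ 2 / g ^ 2))) ∧
      (∀ (g ω T ε κ : ℝ) (ν : ℕ) (𝒩 : Set (ProbabilityMeasure ℝ)),
        0 < g → ω ≠ 0 → 0 < T → 0 ≤ ε → κ ≤ 1 → TDI.deltaTDI ε ⊆ 𝒩 →
        (TDI.epsStar g ω T ≤ ε →
          ENNReal.ofReal ((1 - κ) ^ 2 * ((1 - C / (g * T)) * TDI.boundLarge ν g ω T))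
            ≤ TDI.lossFE κ 𝒩 ν g ω T) ∧
        (ε < TDI.epsStar g ω T →
          ENNReal.ofReal ((1 - κ) ^ 2 * ((1 - C / (g * T)) * TDI.boundSmall ν g ω T ε))
            ≤ TDI.lossFE κ 𝒩 ν g ω T))) ∧
    (∀ g ω : ℝ, ω ≠ 0 →
      Tendsto (fun p : ℕ × ℝ => TDI.boundLarge p.1 g ω p.2 / TDI.heisenbergLimit p.1 p.2)
        (atTop ×ˢ atTop) (𝓝 (g ^ 2 / ω ^ 2))) := by
  refine ⟨TDI.qfiFE_zero_coupling, fun g ω T ε κ ν 𝒩 hω hκ h𝒩 =>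
    iSup₂_le fun ξ hξ => TDI.div_le_lossFE hω hκ h𝒩 hξ, ⟨17, by norm_num, ?_, ?_, ?_⟩,
    fun g ω => TDI.tendsto_boundLarge_div_heisenbergLimit g⟩
  · intro g ω t hg
    refine (TDI.qfiFE_le_cos_two_mul_of_coupling_pos hg ω t).trans (ENNReal.ofReal_le_ofReal ?_)
    gcongr
    norm_num
  · exact fun g ω T ξ hg hT => TDI.qfiFE_le_of_coupling_pos_of_long_time hg hT
  · intro g ω T ε κ ν 𝒩 hg hω hT hε₀ hκ h𝒩
    have hweaken {b : ℝ} (hb : 0 ≤ b) :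
        ENNReal.ofReal ((1 - κ) ^ 2 * ((1 - 17 / (g * T)) * b)) ≤
          ENNReal.ofReal ((1 - κ) ^ 2 * ((1 - 6 / (g * T)) * b)) := by
      gcongr
      norm_num
    have hlarge : 0 ≤ TDI.boundLarge ν g ω T := by unfold TDI.boundLarge; positivity
    have hsmall : 0 ≤ TDI.boundSmall ν g ω T ε := by unfold TDI.boundSmall; positivity
    exact ⟨fun hε => (hweaken hlarge).trans (TDI.boundLarge_le_lossFE hg hω hT hκ h𝒩 hε),
      fun hε => (hweaken hsmall).trans (TDI.boundSmall_le_lossFE hg hω hT hκ h𝒩 hε₀ hε.le)⟩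

theorem mainTheorem2 :
    -- without the environment the maximal QFI is `T²`, so the Heisenberg limit is `1/(νT²)`
    (∀ ω T : ℝ, 0 < T → TDI.qfiFE 0 ω T = ENNReal.ofReal (T ^ 2)) ∧
    -- bias-optimized biased Cramér-Rao bound
    (∀ (g ω T ε κ : ℝ) (ν : ℕ) (𝒩 : Set (ProbabilityMeasure ℝ)),
      0 ≤ g → ω ≠ 0 → 0 < T → 0 ≤ ε → 0 ≤ κ → κ ≤ 1 → 1 ≤ ν →
      (𝒩 = TDI.deltaTDI ε ∨ 𝒩 = TDI.boundedTDI ε) →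
      (⨆ ξ ∈ Set.Icc (-ε) ε,
          ENNReal.ofReal ((1 - κ) ^ 2) /
            (ENNReal.ofReal (1 / ω ^ 2) + (ν : ℝ≥0∞) * TDI.qfiFE g ω (T * (1 + ξ))))
        ≤ TDI.lossFE κ 𝒩 ν g ω T) ∧
    -- the bounds in the strong-coupling regime, with one absolute constant `C`
    (∃ C : ℝ, 0 < C ∧
      (∀ g ω T ξ : ℝ, 0 < g → |ω| ≤ g → 0 < T →
        TDI.qfiFE g ω (T * (1 + ξ)) ≤ ENNReal.ofReal
          (2 * (g * (T * (1 + ξ)) * Real.cos (TDI.rabi g ω * (T * (1 + ξ)))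
                + Real.sin (TDI.rabi g ω * (T * (1 + ξ)))) ^ 2
              / (g ^ 2 * (Real.cos (2 * (T * (1 + ξ)) * TDI.rabi g ω) + 3))
            + C * (ω ^ 2 * (T * (1 + ξ)) ^ 2 / g ^ 2))) ∧
      (∀ g ω T ξ : ℝ, 0 < g → |ω| ≤ g → 0 < T → g ≤ ω ^ 2 * T → |ξ| ≤ 1 →
        TDI.qfiFE g ω (T * (1 + ξ)) ≤ ENNReal.ofReal
          (2 * T ^ 2 * (1 + ξ) ^ 2 * Real.cos (T * TDI.rabi g ω * (1 + ξ)) ^ 2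
              / (Real.cos (2 * T * (1 + ξ) * TDI.rabi g ω) + 3)
            + C * (ω ^ 2 * T ^ 2 / g ^ 2))) ∧
      (∀ (g ω T ε κ : ℝ) (ν : ℕ) (𝒩 : Set (ProbabilityMeasure ℝ)),
        0 < g → ω ≠ 0 → |ω| ≤ g → 1 ≤ g * T → 0 ≤ ε → 0 ≤ κ → κ ≤ 1 → 1 ≤ ν →
        (𝒩 = TDI.deltaTDI ε ∨ 𝒩 = TDI.boundedTDI ε) →
        (TDI.epsStar g ω T ≤ ε →
          ENNReal.ofReal ((1 - κ) ^ 2 *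
            ((1 - C / (g * T)) * TDI.boundLarge ν g ω T
              - C * (ν * ω ^ 8 * T ^ 2 / (g ^ 2 + ν * T ^ 2 * ω ^ 4) ^ 2)))
            ≤ TDI.lossFE κ 𝒩 ν g ω T) ∧
        (ε < TDI.epsStar g ω T →
          ENNReal.ofReal ((1 - κ) ^ 2 *
            ((1 - C / (g * T)) * TDI.boundSmall ν g ω T ε
              - C * (ω ^ 4 / (ν * T ^ 2 *
                  (g ^ 2 * Real.cos (T * TDI.rabi g ω * ε) ^ 2 + ω ^ 2) ^ 2))))
            ≤ TDI.lossFE κ 𝒩 ν g ω T))) ∧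
    -- for large `ν` and `T` the bound is a factor `g²/ω²` above the Heisenberg limit
    (∀ g ω : ℝ, 0 < g → ω ≠ 0 →
      Tendsto (fun p : ℕ × ℝ => TDI.boundLarge p.1 g ω p.2 / TDI.heisenbergLimit p.1 p.2)
        (atTop ×ˢ atTop) (𝓝 (g ^ 2 / ω ^ 2))) := by
  obtain ⟨hfree, hcramerRao, ⟨C, hC, hqfi, hqfi_long, hloss⟩, hratio⟩ := mainTheorem2_general
  refine ⟨fun ω T _ => hfree ω T, fun g ω T ε κ ν 𝒩 _ hω _ _ _ hκ _ h𝒩 =>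
    hcramerRao g ω T ε κ ν 𝒩 hω hκ (TDI.deltaTDI_subset h𝒩),
    ⟨C, hC, fun g ω T ξ hg _ _ => hqfi g ω _ hg, fun g ω T ξ hg _ => hqfi_long g ω T ξ hg, ?_⟩,
    fun g ω _ => hratio g ω⟩
  intro g ω T ε κ ν 𝒩 hg hω _ hgT hε _ hκ _ h𝒩
  have hT : 0 < T := pos_of_mul_pos_right (zero_lt_one.trans_le hgT) hg.le
  have hdrop {a c : ℝ} (hc : 0 ≤ c) : (1 - κ) ^ 2 * (a - c) ≤ (1 - κ) ^ 2 * a :=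
    mul_le_mul_of_nonneg_left (sub_le_self a hc) (sq_nonneg _)
  exact (hloss g ω T ε κ ν 𝒩 hg hω hT hε hκ (TDI.deltaTDI_subset h𝒩)).imp
    (fun hlarge h => (ENNReal.ofReal_le_ofReal (hdrop (by positivity))).trans (hlarge h))
    (fun hsmall h => (ENNReal.ofReal_le_ofReal (hdrop (by positivity))).trans (hsmall h))
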